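/- **Setting.** Let $d\ge 1$, $T\ge 2$, $\mathcal X=\{x\in\mathbb R^d:\ \|x\|_2\le 1,\ x_1=\tfrac12\}$. An oblivious adversary fixes $(x_1,y_1),\dots,(x_T,y_T)\in\mathcal X\times\{0,1\}$ in advance, with full knowledge of the algorithm. An online algorithm, given $T$ and $d$, fixes an integer $N\ge1$ and the grid $\mathcal Z=\{0,\tfrac1N,\dots,1\}$. In each round $t=1,\dots,T$ it sees $x_t$, computes a probability distribution $\mathcal P_t$ on $\mathcal Z$, draws a prediction $p_t\sim\mathcal P_t$ with fresh randomness, and then sees $y_t$. Let $\mathcal L^{\mathsf{cvx}}$ be the class of losses $\ell:[0,1]\times\{0,1\}\to[-1,1]$ such that $\ell(\cdot,y)$ is convex and $1$-Lipschitz for each $y\in\{0,1\}$. Let $$\mathcal F^{\mathsf{aff}}_{\mathsf{res}}=\Big\{x\mapsto \tfrac{1+\langle\theta,x\rangle}{2}:\ \theta\in\mathbb R^d,\ \|\theta\|_2\le1\Big\}.$$ For each $\ell\in\mathcal L^{\mathsf{cvx}}$ let $k_\ell:[0,1]\to[0,1]$ be a best-response function, $k_\ell(q)\in\arg\min_{p\in[0,1]}\mathbb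 E_{y\sim\mathsf{Ber}(q)}[\ell(p,y)]$ (ties broken in an arbitrary fixed way). The swap omniprediction error is $$\mathsf{SOmni}_{\mathcal L^{\mathsf{cvx}},\mathcal F^{\mathsf{aff}}_{\mathsf{res}}}=\sup_{\{\ell_p\in\mathcal L^{\mathsf{cvx}},\,f_p\in\mathcal F^{\mathsf{aff}}_{\mathsf{res}}\}_{p\in\mathcal Z}}\ \sum_{t=1}^T\Big(\ell_{p_t}\big(k_{\ell_{p_t}}(p_t),y_t\big)-\ell_{p_t}\big(f_{p_t}(x_t),y_t\big)\Big).$$ **Theorem.** There are an online algorithm, whose total running time over the $T$ rounds is polynomial in $T$ and $d$ (on a real random access machine: unit-cost exact arithmetic operations and comparisons of real numbers and of integer indices, one uniform program for all $T$ and $d$), and an absolute constant $C$ such that for all $T\ge2$, all $d\ge1$, all sequences $(x_t,y_t)_{t\le T}$ in $\mathcal X\times\{0,1\}$ and all choices of the best-response functions $k_\ell$: for every $\delta\in(0,1)$, with probability at least $1-\delta$, $$\mathsf{SOmni}_{\mathcal L^{\mathsf{cvx}},\mathcal F^{\mathsf{aff}}_{\mathsf{res}}}\le C\Big(T^{2/3}d^{1/3}(\log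 T)^{1/3}+T^{2/3}(d\log T)^{-1/6}\sqrt{\log\tfrac1\delta}\Big),$$ and moreover $$\mathbb E\big[\mathsf{SOmni}_{\mathcal L^{\mathsf{cvx}},\mathcal F^{\mathsf{aff}}_{\mathsf{res}}}\big]\le C\,T^{2/3}d^{1/3}(\log T)^{1/3}.$$ Probability and expectation are over the internal randomness of the algorithm. -/

import Mathlib

open Set MeasureTheory

noncomputable section

namespace SwapOmni

/-! ### Losses, post-processing, hypotheses, swap omniprediction error -/

/-- A loss `ℓ p y` of a prediction `p ∈ [0, 1]` and a binary label (`true` is `1`, `false` is `0`).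
Only the values at `p ∈ [0, 1]` are ever used. -/
abbrev Loss : Type := ℝ → Bool → ℝ

/-- The class `L^cvx`: for each label, convex in the prediction on `[0, 1]`, with values in
`[-1, 1]`, and `1`-Lipschitz on `[0, 1]`. -/
def convexLipschitzLosses : Set Loss :=
  {ℓ | ∀ y : Bool, ConvexOn ℝ (Icc 0 1) (fun p => ℓ p y) ∧
    (∀ p ∈ Icc (0 : ℝ) 1, ℓ p y ∈ Icc (-1 : ℝ) 1) ∧
    LipschitzOnWith 1 (fun p => ℓ p y) (Icc 0 1)}

/-- The expectation of `ℓ p y` over `y ∼ Ber(q)`. -/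
def expectedLoss (ℓ : Loss) (q p : ℝ) : ℝ := q * ℓ p true + (1 - q) * ℓ p false

/-- `κ` is a best-response (post-processing) function for `ℓ`: for each `q ∈ [0, 1]`, the value
`κ q ∈ [0, 1]` is a minimizer over `[0, 1]` of the expected loss under `y ∼ Ber(q)`. -/
def IsBestResponse (ℓ : Loss) (κ : ℝ → ℝ) : Prop :=
  ∀ q ∈ Icc (0 : ℝ) 1, κ q ∈ Icc (0 : ℝ) 1 ∧ IsMinOn (expectedLoss ℓ q) (Icc 0 1) (κ q)

/-- The contexts: the vectors of the closed Euclidean unit ball with first coordinate `1/2`. -/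
def contexts (d : ℕ) [NeZero d] : Set (EuclideanSpace ℝ (Fin d)) :=
  {x | ‖x‖ ≤ 1 ∧ x 0 = 1 / 2}

/-- The hypotheses `x ↦ (1 + ⟨θ, x⟩) / 2` with `‖θ‖ ≤ 1`. -/
def restrictedAffine (d : ℕ) : Set (EuclideanSpace ℝ (Fin d) → ℝ) :=
  {f | ∃ θ : EuclideanSpace ℝ (Fin d), ‖θ‖ ≤ 1 ∧ f = fun x => (1 + inner ℝ θ x) / 2}

/-- The `i`-th point `i / N` of the prediction grid `{0, 1/N, …, 1}`. -/
def gridPoint (N : ℕ) (i : Fin (N + 1)) : ℝ := (i : ℝ) / N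

/-- The swap omniprediction error of the realized predictions against one loss profile `ℓ` and one
comparator profile `f`, both indexed by the points of the grid. The rounds are `0, …, T - 1`, the
prediction of round `t` is the grid point with index `p t`, and `k ℓ` is the post-processing
function of the loss `ℓ`. -/
def profileError {X : Type*} {T N : ℕ} (k : Loss → ℝ → ℝ) (x : ℕ → X) (y : ℕ → Bool)
    (p : Fin T → Fin (N + 1)) (ℓ : Fin (N + 1) → Loss) (f : Fin (N + 1) → X → ℝ) : ℝ :=
  ∑ t : Fin T, (ℓ (p t) (k (ℓ (p t)) (gridPoint N (p t))) (y t) - ℓ (p t) (f (p t) (x t)) (y t))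

/-- The swap omniprediction error: the supremum of `profileError` over all loss profiles in `L` and
all comparator profiles in `F`. -/
def swapOmniprediction {X : Type*} (L : Set Loss) (F : Set (X → ℝ)) {T N : ℕ}
    (k : Loss → ℝ → ℝ) (x : ℕ → X) (y : ℕ → Bool) (p : Fin T → Fin (N + 1)) : ℝ :=
  sSup {r | ∃ (ℓ : Fin (N + 1) → Loss) (f : Fin (N + 1) → X → ℝ),
    (∀ v, ℓ v ∈ L) ∧ (∀ v, f v ∈ F) ∧ r = profileError k x y p ℓ f}

/-! ### A real random access machine with a step count

Programs act on integer variables and on real arrays. Every operation on integers (sum, truncated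
difference, comparison), on reals (the four field operations, comparison) and every memory access
costs one step; the bodies of loops are charged at every iteration. There are no other primitives,
in particular no rounding of reals and no transcendental functions. -/

/-- The memory: integer variables `nat v`, and real arrays `real a` with cells `(i, j, k)`. -/
structure Store where
  nat : ℕ → ℕ
  real : ℕ → ℕ → ℕ → ℕ → ℝ

/-- Assignment to an integer variable. -/
def Store.setNat (s : Store) (v n : ℕ) : Store :=
  { s with nat := fun v' => if v' = v then n else s.nat v' }

/-- Assignment to a single cell of a real array. -/
def Store.setReal (s : Store) (a i j k : ℕ) (r : ℝ) : Store :=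
  { s with real := fun a' i' j' k' =>
      if a' = a ∧ i' = i ∧ j' = j ∧ k' = k then r else s.real a' i' j' k' }

/-- Integer expressions. -/
inductive NatTerm : Type
  | const (n : ℕ)
  | var (v : ℕ)
  | plus (e₁ e₂ : NatTerm)
  | minus (e₁ e₂ : NatTerm)

def NatTerm.eval (s : Store) : NatTerm → ℕ
  | .const n => n
  | .var v => s.nat v
  | .plus e₁ e₂ => e₁.eval s + e₂.eval s
  | .minus e₁ e₂ => e₁.eval s - e₂.eval s

/-- The number of steps needed to evaluate an integer expression. -/
def NatTerm.cost : NatTerm → ℕ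
  | .const _ => 1
  | .var _ => 1
  | .plus e₁ e₂ => e₁.cost + e₂.cost + 1
  | .minus e₁ e₂ => e₁.cost + e₂.cost + 1

/-- Real expressions: rational constants, conversion of integers, access to array cells, and the
field operations (with `r / 0 = 0`). -/
inductive RealTerm : Type
  | const (q : ℚ)
  | ofNat (e : NatTerm)
  | cell (a : ℕ) (i j k : NatTerm)
  | plus (e₁ e₂ : RealTerm)
  | minus (e₁ e₂ : RealTerm)
  | times (e₁ e₂ : RealTerm)
  | quot (e₁ e₂ : RealTerm)

def RealTerm.eval (s : Store) : RealTerm → ℝ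
  | .const q => (q : ℝ)
  | .ofNat e => (e.eval s : ℝ)
  | .cell a i j k => s.real a (i.eval s) (j.eval s) (k.eval s)
  | .plus e₁ e₂ => e₁.eval s + e₂.eval s
  | .minus e₁ e₂ => e₁.eval s - e₂.eval s
  | .times e₁ e₂ => e₁.eval s * e₂.eval s
  | .quot e₁ e₂ => e₁.eval s / e₂.eval s

/-- The number of steps needed to evaluate a real expression. -/
def RealTerm.cost : RealTerm → ℕ
  | .const _ => 1
  | .ofNat e => e.cost + 1
  | .cell _ i j k => i.cost + j.cost + k.cost + 1
  | .plus e₁ e₂ => e₁.cost + e₂.cost + 1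
  | .minus e₁ e₂ => e₁.cost + e₂.cost + 1
  | .times e₁ e₂ => e₁.cost + e₂.cost + 1
  | .quot e₁ e₂ => e₁.cost + e₂.cost + 1

/-- Comparisons of integers or of reals. -/
inductive Test : Type
  | natLE (e₁ e₂ : NatTerm)
  | realLE (e₁ e₂ : RealTerm)

def Test.holds (s : Store) : Test → Prop
  | .natLE e₁ e₂ => e₁.eval s ≤ e₂.eval s
  | .realLE e₁ e₂ => e₁.eval s ≤ e₂.eval s

/-- The number of steps needed to perform a comparison. -/
def Test.cost : Test → ℕ
  | .natLE e₁ e₂ => e₁.cost + e₂.cost + 1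
  | .realLE e₁ e₂ => e₁.cost + e₂.cost + 1

/-- Programs. `loop v e c` evaluates `e` once, to `n` say, and then runs `c` with the variable `v`
set to `0, 1, …, n - 1` in turn. -/
inductive Program : Type
  | skip
  | setNat (v : ℕ) (e : NatTerm)
  | setReal (a : ℕ) (i j k : NatTerm) (e : RealTerm)
  | seq (c₁ c₂ : Program)
  | ite (b : Test) (c₁ c₂ : Program)
  | loop (v : ℕ) (e : NatTerm) (c : Program)

/-- The memory after `n` iterations of the loop with variable `v` and with a body that acts on the
memory by `body`. -/
def iterate (v : ℕ) (body : Store → Store) (s : Store) : ℕ → Store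
  | 0 => s
  | n + 1 => body ((iterate v body s n).setNat v n)

open Classical in
/-- The effect of a program on the memory. -/
def Program.exec : Program → Store → Store
  | .skip => fun s => s
  | .setNat v e => fun s => s.setNat v (e.eval s)
  | .setReal a i j k e => fun s => s.setReal a (i.eval s) (j.eval s) (k.eval s) (e.eval s)
  | .seq c₁ c₂ => fun s => c₂.exec (c₁.exec s)
  | .ite b c₁ c₂ => fun s => if b.holds s then c₁.exec s else c₂.exec s
  | .loop v e c => fun s => iterate v c.exec s (e.eval s)

open Classical in
/-- The number of steps that a program takes from a given memory. -/
def Program.time : Program → Store → ℕ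
  | .skip => fun _ => 1
  | .setNat _ e => fun _ => e.cost + 1
  | .setReal _ i j k e => fun _ => i.cost + j.cost + k.cost + e.cost + 1
  | .seq c₁ c₂ => fun s => c₁.time s + c₂.time (c₁.exec s)
  | .ite b c₁ c₂ => fun s => b.cost + if b.holds s then c₁.time s else c₂.time s
  | .loop v e c => fun s => e.cost + 1 +
      ∑ i ∈ Finset.range (e.eval s), (1 + c.time ((iterate v c.exec s i).setNat v i))

/-! ### Online forecasting algorithms

A single uniform algorithm consists of three programs that share the memory. The horizon `T` and
the dimension `d` are given in the integer variables `0` and `1`. The program `init` runs first, and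
leaves the discretization parameter `N` in the integer variable `2`. In each round the coordinates
of the context are placed in the real array `0`; the program `predict` runs and leaves the
conditional distribution `P_t` of the prediction in the real array `2`, the probability of `i / N` in
the cell `(i, 0, 0)`; the prediction is drawn from `P_t` with fresh randomness; the label is placed
in the cell `(0, 0, 0)` of the real array `1`; and the program `update` runs. -/

structure OnlineAlgorithm where
  init : Program
  predict : Program
  update : Program

namespace OnlineAlgorithm

variable (A : OnlineAlgorithm) (T : ℕ) {d : ℕ}

/-- The initial memory: zero but for the inputs `T` and `d`. -/
def startStore (T d : ℕ) : Store where
  nat v := if v = 0 then T else if v = 1 then d else 0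
  real _ _ _ _ := 0

/-- The real array `0` is overwritten by the coordinates of the context. -/
def writeContext (x : EuclideanSpace ℝ (Fin d)) (s : Store) : Store :=
  { s with real := fun a i j k =>
      if a = 0 then (if h : i < d ∧ j = 0 ∧ k = 0 then x ⟨i, h.1⟩ else 0) else s.real a i j k }

/-- The label is written as a real number, `1` or `0`. -/
def writeLabel (y : Bool) (s : Store) : Store :=
  s.setReal 1 0 0 0 (if y then 1 else 0)

/-- The discretization parameter `N` chosen for the horizon `T` and the dimension `d`. -/
def gridSize (d : ℕ) : ℕ := (A.init.exec (startStore T d)).nat 2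

/-- The memory at the beginning of round `t`. -/
def storeBefore (x : ℕ → EuclideanSpace ℝ (Fin d)) (y : ℕ → Bool) : ℕ → Store
  | 0 => A.init.exec (startStore T d)
  | t + 1 =>
    A.update.exec (writeLabel (y t) (A.predict.exec (writeContext (x t) (storeBefore x y t))))

/-- The memory of round `t` after the program `predict` has run: it depends on the contexts of the
rounds up to `t` and on the labels of the rounds before `t`. -/
def storePredicted (x : ℕ → EuclideanSpace ℝ (Fin d)) (y : ℕ → Bool) (t : ℕ) : Store :=
  A.predict.exec (writeContext (x t) (A.storeBefore T x y t))

/-- The weights `P_t(i / N)` that the algorithm outputs in round `t`. -/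
def weights (x : ℕ → EuclideanSpace ℝ (Fin d)) (y : ℕ → Bool) (t : ℕ) :
    Fin (A.gridSize T d + 1) → ℝ :=
  fun i => (A.storePredicted T x y t).real 2 i 0 0

/-- The law of the indices of the predictions of the rounds `0, …, T - 1`: since `P_t` does not
depend on earlier draws, it is the product of the conditional distributions. -/
def law (x : ℕ → EuclideanSpace ℝ (Fin d)) (y : ℕ → Bool) :
    Measure (Fin T → Fin (A.gridSize T d + 1)) :=
  Measure.pi fun t : Fin T =>
    ∑ i, ENNReal.ofReal (A.weights T x y t i) • Measure.dirac i

/-- The number of steps over all `T` rounds. Drawing a prediction is charged `N + 1` steps. -/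
def totalTime (x : ℕ → EuclideanSpace ℝ (Fin d)) (y : ℕ → Bool) : ℕ :=
  A.init.time (startStore T d) +
    ∑ t ∈ Finset.range T,
      (A.predict.time (writeContext (x t) (A.storeBefore T x y t)) +
        (A.gridSize T d + 1) +
        A.update.time (writeLabel (y t) (A.storePredicted T x y t)))

end OnlineAlgorithm

end SwapOmni

end

noncomputable section

namespace SwapOmni

/-! The error is first reduced to one vector per grid point. On the rounds with prediction v, let
S_v be the sum of (y_t - v) x_t. Since the first coordinate of every context is 1/2, ‖S_v‖ controls
the bias of the residuals y_t - v, and by linearity also their correlation with every comparator.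
Replacing a comparator by its mean over the bucket costs O(‖S_v‖), by Jensen's inequality on the
rounds of each label separately. The best response to v beats this constant up to O(‖S_v‖), because
a loss is affine in the label. Hence `swapOmniprediction_le`: the error is at most 15 ∑_v ‖S_v‖,
uniformly over losses and comparators, so no union bound over profiles is needed.

The forecasts do not depend on earlier draws, so the draws are independent. A variance computation
then shows that sampling adds √((N+1)T) to the mean vectors in expectation
(`integral_sum_norm_bucketSum_le`), and McDiarmid's inequality gives the tail
(`one_sub_le_measureReal_sum_norm_bucketSum`).

For the mean vectors, each bucket runs an online ridge regression that predicts the residual of the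
round by u_t(v), each round being weighted by its probability w_t(v). By
`dotProduct_residualSum_le`, the squared norm of the mean vector is at most (4 + total weight) times
the sum of w (2 r u - u²/2) plus O(d log(d + T)). Defensive forecasting chooses w_t after seeing
u_t: mixing the two neighbouring grid points where u_t changes sign makes the mean of u_t vanish, so
the label drops out. What remains, 2c/N with c of the size of u_t, is offset by the term -u²/2 and
leaves only 1/N² per round (`sum_defensiveWeights_mul_le`). This gain over 1/N produces the rate.

Cauchy–Schwarz over the buckets gives, up to constants, √(T (T/N² + N d log T)) when d log T ≤ T,
and N ≈ (T/(d log T))^(1/3) balances the two terms. If d log T exceeds T, the trivial bound T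
suffices.

Finally, the forecaster is written as a program. `storeInvariant` shows that its arrays hold the
inverse Gram matrices, updated by Sherman–Morrison, and the residual sums; `exists_totalTime_le`
bounds the running time through the loop bounds. -/

/-! ### From swap omniprediction to the residual sums of the buckets -/

/-- Numerical value of a binary label. -/
def labelValue (y : Bool) : ℝ := if y then 1 else 0

/-- Jensen's inequality around an arbitrary reference point, for a convex `1`-Lipschitz function. -/
lemma card_mul_sub_abs_le_sum {ι : Type*} (s : Finset ι) {φ : ℝ → ℝ}
    (hc : ConvexOn ℝ (Icc 0 1) φ) (hl : LipschitzOnWith 1 φ (Icc 0 1)) {g : ι → ℝ}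
    (hg : ∀ i ∈ s, g i ∈ Icc (0 : ℝ) 1) {m : ℝ} (hm : m ∈ Icc (0 : ℝ) 1) :
    (s.card : ℝ) * φ m - |∑ i ∈ s, (g i - m)| ≤ ∑ i ∈ s, φ (g i) := by
  rcases s.eq_empty_or_nonempty with rfl | hs
  · simp
  have hn : (0 : ℝ) < s.card := by exact_mod_cast hs.card_pos
  have hw : ∑ i ∈ s, (s.card : ℝ)⁻¹ = 1 := by
    rw [Finset.sum_const, nsmul_eq_mul, mul_inv_cancel₀ hn.ne']
  -- Jensen gives the bound at the mean of `g`; the Lipschitz property then moves the mean to `m`,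
  -- and the cost, multiplied by the cardinality, is exactly the absolute value in the statement.
  have hJ := hc.map_sum_le (t := s) (w := fun _ => (s.card : ℝ)⁻¹) (p := g)
    (fun _ _ => by positivity) hw hg
  have hmem := (convex_Icc (0 : ℝ) 1).sum_mem (t := s) (w := fun _ => (s.card : ℝ)⁻¹) (z := g)
    (fun _ _ => by positivity) hw hg
  simp only [smul_eq_mul, ← Finset.mul_sum] at hJ hmem
  have hL := hl.dist_le_mul _ hm _ hmem
  rw [Real.dist_eq, Real.dist_eq, NNReal.coe_one, one_mul] at hL
  have h1 := (abs_le.1 hL).2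
  have h2 : |m - (s.card : ℝ)⁻¹ * ∑ i ∈ s, g i| * s.card = |∑ i ∈ s, (g i - m)| := by
    rw [← abs_of_pos hn, ← abs_mul, abs_of_pos hn, ← abs_neg]
    congr 1
    rw [Finset.sum_sub_distrib, Finset.sum_const, nsmul_eq_mul]
    field_simp
    ring
  have h3 : (s.card : ℝ) * φ ((s.card : ℝ)⁻¹ * ∑ i ∈ s, g i) ≤ ∑ i ∈ s, φ (g i) := by
    calc _ ≤ (s.card : ℝ) * ((s.card : ℝ)⁻¹ * ∑ i ∈ s, φ (g i)) :=
          mul_le_mul_of_nonneg_left hJ hn.le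
      _ = _ := by field_simp
  nlinarith

/-- A function of a binary label is affine in the label, so the realized loss differs from the loss
expected under Ber(v) by a multiple of the residual. -/
lemma loss_eq_expectedLoss_add (ℓ : Loss) (v p : ℝ) (y : Bool) :
    ℓ p y = expectedLoss ℓ v p + (labelValue y - v) * (ℓ p true - ℓ p false) := by
  cases y <;> simp [expectedLoss, labelValue] <;> ring

/-- On a set of rounds with the same prediction `v`, the regret of the best response to `v` is
controlled by the correlation of the residuals with the contexts. -/
lemma sum_loss_sub_le {ι : Type*} (s : Finset ι) {d : ℕ} [NeZero d]
    {x : ι → EuclideanSpace ℝ (Fin d)} (hx : ∀ i ∈ s, x i ∈ contexts d) (y : ι → Bool)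
    {ℓ : Loss} (hℓ : ℓ ∈ convexLipschitzLosses) {v q : ℝ} (hq : q ∈ Icc (0 : ℝ) 1)
    (hmin : IsMinOn (expectedLoss ℓ v) (Icc 0 1) q)
    {f : EuclideanSpace ℝ (Fin d) → ℝ} (hf : f ∈ restrictedAffine d) :
    ∑ i ∈ s, (ℓ q (y i) - ℓ (f (x i)) (y i)) ≤
      15 * ‖∑ i ∈ s, (labelValue (y i) - v) • x i‖ := by
  obtain ⟨θ, hθ, rfl⟩ := hf
  rcases s.eq_empty_or_nonempty with rfl | hs
  · simp
  have hn : (0 : ℝ) < s.card := by exact_mod_cast hs.card_pos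
  set R := ‖∑ i ∈ s, (labelValue (y i) - v) • x i‖ with hR
  set g : ι → ℝ := fun i => (1 + inner ℝ θ (x i)) / 2 with hg
  have hgm : ∀ i ∈ s, g i ∈ Icc (0 : ℝ) 1 := by
    intro i hi
    have h1 := abs_real_inner_le_norm θ (x i)
    have h2 : ‖θ‖ * ‖x i‖ ≤ 1 := mul_le_one₀ hθ (norm_nonneg _) (hx i hi).1
    have h3 := abs_le.1 (h1.trans h2)
    simp only [hg]
    constructor <;> linarith [h3.1, h3.2]
  set m : ℝ := (s.card : ℝ)⁻¹ * ∑ i ∈ s, g i with hm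
  have hmm : m ∈ Icc (0 : ℝ) 1 := by
    have := (convex_Icc (0 : ℝ) 1).sum_mem (t := s) (w := fun _ => (s.card : ℝ)⁻¹) (z := g)
      (fun _ _ => by positivity)
      (by rw [Finset.sum_const, nsmul_eq_mul, mul_inv_cancel₀ hn.ne']) hgm
    simpa only [smul_eq_mul, ← Finset.mul_sum] using this
  have hzero : ∑ i ∈ s, (g i - m) = 0 := by
    rw [Finset.sum_sub_distrib, Finset.sum_const, nsmul_eq_mul, hm]
    field_simp
    ring
  -- the residuals are nearly unbiased
  have hbias : |∑ i ∈ s, (labelValue (y i) - v)| ≤ 2 * R := by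
    have h1 : (∑ i ∈ s, (labelValue (y i) - v) • x i) 0 =
        (∑ i ∈ s, (labelValue (y i) - v)) * (1 / 2) := by
      rw [WithLp.ofLp_sum, Finset.sum_apply, Finset.sum_mul]
      refine Finset.sum_congr rfl fun i hi => ?_
      simp [(hx i hi).2]
    have h2 := PiLp.norm_apply_le (∑ i ∈ s, (labelValue (y i) - v) • x i) 0
    rw [h1, Real.norm_eq_abs, abs_mul, abs_of_pos (by norm_num : (0 : ℝ) < 1 / 2)] at h2
    linarith
  -- The constant is half of the bias bound 2R plus half of |⟨θ, S⟩| ≤ R.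
  have hcorr : |∑ i ∈ s, (labelValue (y i) - v) * g i| ≤ 3 / 2 * R := by
    have h1 : ∑ i ∈ s, (labelValue (y i) - v) * g i =
        (∑ i ∈ s, (labelValue (y i) - v)) / 2 +
          inner ℝ θ (∑ i ∈ s, (labelValue (y i) - v) • x i) / 2 := by
      rw [inner_sum, Finset.sum_div, Finset.sum_div, ← Finset.sum_add_distrib]
      refine Finset.sum_congr rfl fun i _ => ?_
      rw [inner_smul_right]
      simp only [hg]
      ring
    have h2 := abs_real_inner_le_norm θ (∑ i ∈ s, (labelValue (y i) - v) • x i)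
    have h3 : ‖θ‖ * R ≤ R := mul_le_of_le_one_left (norm_nonneg _) hθ
    rw [h1]
    have h4 := abs_le.1 (h2.trans h3)
    have h5 := abs_le.1 hbias
    rw [abs_le]
    constructor <;> linarith [h4.1, h4.2, h5.1, h5.2]
  -- `D` is the sum of g - m over the rounds with label 1. As g - m has total sum zero, labels may
  -- be replaced by residuals here, and the sum over the rounds with label 0 is -D; one bound thus
  -- serves both applications of Jensen.
  set D := ∑ i ∈ s, (labelValue (y i)) * (g i - m) with hD
  have hDb : |D| ≤ 7 / 2 * R := by
    have h1 : D = ∑ i ∈ s, (labelValue (y i) - v) * g i - m * ∑ i ∈ s, (labelValue (y i) - v) := by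
      have : D = D - v * ∑ i ∈ s, (g i - m) := by rw [hzero]; ring
      rw [this, hD, Finset.mul_sum, Finset.mul_sum, ← Finset.sum_sub_distrib,
        ← Finset.sum_sub_distrib]
      exact Finset.sum_congr rfl fun i _ => by ring
    have h2 : |m * ∑ i ∈ s, (labelValue (y i) - v)| ≤ 2 * R := by
      rw [abs_mul, abs_of_nonneg hmm.1]
      exact (mul_le_of_le_one_left (abs_nonneg _) hmm.2).trans hbias
    rw [h1]
    exact (abs_sub _ _).trans (by linarith)
  -- Jensen's inequality for each label
  have hsplit : ∀ F : ι → ℝ, ∑ i ∈ s, F i =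
      ∑ i ∈ s.filter (fun i => y i = true), F i + ∑ i ∈ s.filter (fun i => ¬ y i = true), F i :=
    fun F => (Finset.sum_filter_add_sum_filter_not s _ F).symm
  have hD1 : ∑ i ∈ s.filter (fun i => y i = true), (g i - m) = D := by
    rw [hD, Finset.sum_filter]
    exact Finset.sum_congr rfl fun i _ => by cases y i <;> simp [labelValue]
  have hD0 : ∑ i ∈ s.filter (fun i => ¬ y i = true), (g i - m) = -D := by
    have := hsplit fun i => g i - m
    rw [hzero, hD1] at this
    linarith
  have hJ1 := card_mul_sub_abs_le_sum (s.filter fun i => y i = true) (hℓ true).1 (hℓ true).2.2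
    (g := g) (fun i hi => hgm i (Finset.mem_filter.1 hi).1) hmm
  have hJ0 := card_mul_sub_abs_le_sum (s.filter fun i => ¬ y i = true) (hℓ false).1 (hℓ false).2.2
    (g := g) (fun i hi => hgm i (Finset.mem_filter.1 hi).1) hmm
  rw [hD1] at hJ1
  rw [hD0, abs_neg] at hJ0
  have hlow : ∑ i ∈ s, ℓ m (y i) - 2 * |D| ≤ ∑ i ∈ s, ℓ (g i) (y i) := by
    have e1 : ∑ i ∈ s.filter (fun i => y i = true), ℓ m (y i) =
        ((s.filter fun i => y i = true).card : ℝ) * ℓ m true := by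
      rw [← nsmul_eq_mul, ← Finset.sum_const]
      exact Finset.sum_congr rfl fun i hi => by rw [(Finset.mem_filter.1 hi).2]
    have e0 : ∑ i ∈ s.filter (fun i => ¬ y i = true), ℓ m (y i) =
        ((s.filter fun i => ¬ y i = true).card : ℝ) * ℓ m false := by
      rw [← nsmul_eq_mul, ← Finset.sum_const]
      exact Finset.sum_congr rfl fun i hi => by
        rw [Bool.eq_false_of_not_eq_true (Finset.mem_filter.1 hi).2]
    have e1' : ∑ i ∈ s.filter (fun i => y i = true), ℓ (g i) (y i) =
        ∑ i ∈ s.filter (fun i => y i = true), ℓ (g i) true :=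
      Finset.sum_congr rfl fun i hi => by rw [(Finset.mem_filter.1 hi).2]
    have e0' : ∑ i ∈ s.filter (fun i => ¬ y i = true), ℓ (g i) (y i) =
        ∑ i ∈ s.filter (fun i => ¬ y i = true), ℓ (g i) false :=
      Finset.sum_congr rfl fun i hi => by
        rw [Bool.eq_false_of_not_eq_true (Finset.mem_filter.1 hi).2]
    rw [hsplit fun i => ℓ m (y i), hsplit fun i => ℓ (g i) (y i), e1, e0, e1', e0']
    linarith
  -- the best response beats the constant `m`
  have hbest : ∑ i ∈ s, (ℓ q (y i) - ℓ m (y i)) ≤ 8 * R := by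
    have h1 : ∀ i ∈ s, ℓ q (y i) - ℓ m (y i) ≤ (labelValue (y i) - v) *
        ((ℓ q true - ℓ q false) - (ℓ m true - ℓ m false)) := by
      intro i _
      rw [loss_eq_expectedLoss_add ℓ v q, loss_eq_expectedLoss_add ℓ v m]
      have := hmin hmm
      simp only [mem_ofPred_eq] at this
      linarith
    refine (Finset.sum_le_sum h1).trans ?_
    rw [← Finset.sum_mul]
    refine (le_abs_self _).trans ?_
    rw [abs_mul]
    have h2 : |(ℓ q true - ℓ q false) - (ℓ m true - ℓ m false)| ≤ 4 := by
      have a1 := (hℓ true).2.1 q hq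
      have a2 := (hℓ false).2.1 q hq
      have a3 := (hℓ true).2.1 m hmm
      have a4 := (hℓ false).2.1 m hmm
      simp only [mem_Icc] at a1 a2 a3 a4
      rw [abs_le]
      constructor <;> linarith
    calc _ ≤ (2 * R) * 4 := mul_le_mul hbias h2 (abs_nonneg _) (by positivity)
      _ = 8 * R := by ring
  -- The constant 15 is 8 from `hbest` plus 2 · 7/2 from `hlow` and `hDb`.
  rw [Finset.sum_sub_distrib] at hbest ⊢
  linarith

/-- The cumulated residual-weighted context of the rounds with prediction `v`. -/
def bucketSum {T N d : ℕ} (x : ℕ → EuclideanSpace ℝ (Fin d)) (y : ℕ → Bool)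
    (p : Fin T → Fin (N + 1)) (v : Fin (N + 1)) : EuclideanSpace ℝ (Fin d) :=
  ∑ t : Fin T, if p t = v then (labelValue (y t) - gridPoint N v) • x t else 0

lemma gridPoint_mem_Icc {N : ℕ} (v : Fin (N + 1)) : gridPoint N v ∈ Icc (0 : ℝ) 1 := by
  unfold gridPoint
  refine ⟨by positivity, div_le_one_of_le₀ ?_ (by positivity)⟩
  exact_mod_cast Nat.le_of_lt_succ v.2

/-- Within one bucket the loss and the comparator are fixed, and the bound for the bucket mentions
neither, so the supremum over profiles costs nothing. -/
theorem swapOmniprediction_le {T N d : ℕ} [NeZero d] {k : Loss → ℝ → ℝ}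
    (hk : ∀ ℓ ∈ convexLipschitzLosses, IsBestResponse ℓ (k ℓ))
    {x : ℕ → EuclideanSpace ℝ (Fin d)} (hx : ∀ t < T, x t ∈ contexts d) (y : ℕ → Bool)
    (p : Fin T → Fin (N + 1)) :
    swapOmniprediction convexLipschitzLosses (restrictedAffine d) k x y p ≤
      15 * ∑ v, ‖bucketSum x y p v‖ := by
  refine Real.sSup_le ?_ (by positivity)
  rintro r ⟨ℓ, f, hℓ, hf, rfl⟩
  unfold profileError
  rw [← Finset.sum_fiberwise (s := Finset.univ) (g := p), Finset.mul_sum]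
  refine Finset.sum_le_sum fun v _ => ?_
  have hb := hk (ℓ v) (hℓ v) _ (gridPoint_mem_Icc v)
  have h := sum_loss_sub_le (Finset.univ.filter fun t => p t = v) (x := fun t : Fin T => x t)
    (fun t _ => hx t t.2) (fun t => y t) (hℓ v) hb.1 hb.2 (hf v)
  rw [bucketSum, ← Finset.sum_filter]
  refine le_trans (le_of_eq ?_) h
  exact Finset.sum_congr rfl fun t ht => by rw [(Finset.mem_filter.1 ht).2]

/-! ### McDiarmid's inequality -/

section BoundedDifferences

open ProbabilityTheory

variable {α : Type*} [Finite α] [Nonempty α] [MeasurableSpace α] [DiscreteMeasurableSpace α]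

/-- The bounded differences estimate for the moment generating function on a finite product. -/
theorem integral_exp_le_of_bounded_differences {c : ℝ} (t : ℝ) :
    ∀ {n : ℕ} (μ : Fin n → Measure α) [∀ i, IsProbabilityMeasure (μ i)] (f : (Fin n → α) → ℝ),
      (∀ p i a b, f (Function.update p i a) - f (Function.update p i b) ≤ c) →
      ∫ p, Real.exp (t * (f p - ∫ q, f q ∂Measure.pi μ)) ∂Measure.pi μ ≤
        Real.exp (n * ((c / 2) ^ 2 * t ^ 2 / 2)) := by
  intro n
  induction n with
  | zero =>
    intro μ _ f _
    have h : ∀ q : Fin 0 → α, f q = f default := fun q => by rw [Subsingleton.elim q default]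
    simp [h]
  | succ n ih =>
    intro μ _ f hf
    set ν : Measure (Fin n → α) := Measure.pi fun i => μ i.succ with hν
    have hmp := (measurePreserving_piFinSuccAbove μ 0).symm
    have hcomp : ∀ F : (Fin (n + 1) → α) → ℝ, ∫ p, F p ∂Measure.pi μ =
        ∫ a, ∫ r, F (Fin.cons a r) ∂ν ∂(μ 0) := by
      intro F
      rw [← hmp.integral_comp' (g := F), integral_prod _ Integrable.of_finite]
      simp only [Fin.zero_succAbove, MeasurableEquiv.piFinSuccAbove_symm_apply,
        Fin.insertNthEquiv, Equiv.coe_fn_mk, Fin.insertNth_zero', hν]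
    -- The conditional mean given the first coordinate. The deviation of `f` splits into that of
    -- `g`, handled by Hoeffding's lemma, and that of `f` around `g` on each fibre, handled by
    -- induction.
    set g : α → ℝ := fun a => ∫ r, f (Fin.cons a r) ∂ν with hg
    have hgdiff : ∀ a b, g a - g b ≤ c := by
      intro a b
      rw [hg]
      simp only
      rw [← integral_sub Integrable.of_finite Integrable.of_finite]
      calc _ ≤ ∫ _ : Fin n → α, c ∂ν := by
            refine integral_mono Integrable.of_finite (integrable_const _) fun r => ?_
            simpa using hf (Fin.cons a r) 0 a b
        _ = c := by simp
    -- The minimum of `g` anchors an interval of length `c` that contains all its values, as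
    -- Hoeffding's lemma requires.
    obtain ⟨a₀, ha₀⟩ := Finite.exists_min g
    have hc : 0 ≤ c := by simpa using hgdiff a₀ a₀
    have hH := (hasSubgaussianMGF_of_mem_Icc (μ := μ 0) (X := g) (a := g a₀) (b := g a₀ + c)
      (measurable_of_finite g).aemeasurable
      (Filter.Eventually.of_forall fun a => ⟨ha₀ a, by linarith [hgdiff a a₀]⟩)).mgf_le t
    have hinner : ∀ a, ∫ r, Real.exp (t * (f (Fin.cons a r) - g a)) ∂ν ≤
        Real.exp (n * ((c / 2) ^ 2 * t ^ 2 / 2)) := by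
      intro a
      refine ih (fun i => μ i.succ) (fun r => f (Fin.cons a r)) fun r i b b' => ?_
      simpa only [Fin.cons_update] using hf (Fin.cons a r) i.succ b b'
    rw [hcomp, hcomp f]
    have hfac : ∀ a, ∫ r, Real.exp (t * (f (Fin.cons a r) - ∫ a, g a ∂(μ 0))) ∂ν =
        Real.exp (t * (g a - ∫ a, g a ∂(μ 0))) *
          ∫ r, Real.exp (t * (f (Fin.cons a r) - g a)) ∂ν := by
      intro a
      rw [← integral_const_mul]
      congr 1 with r
      rw [← Real.exp_add]
      congr 1
      ring
    simp only [mgf] at hH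
    calc _ = ∫ a, Real.exp (t * (g a - ∫ a, g a ∂(μ 0))) *
          ∫ r, Real.exp (t * (f (Fin.cons a r) - g a)) ∂ν ∂(μ 0) := by
          congr 1 with a; exact hfac a
      _ ≤ ∫ a, Real.exp (t * (g a - ∫ a, g a ∂(μ 0))) *
          Real.exp (n * ((c / 2) ^ 2 * t ^ 2 / 2)) ∂(μ 0) :=
          integral_mono Integrable.of_finite Integrable.of_finite fun a =>
            mul_le_mul_of_nonneg_left (hinner a) (Real.exp_nonneg _)
      _ ≤ Real.exp ((c / 2) ^ 2 * t ^ 2 / 2) * Real.exp (n * ((c / 2) ^ 2 * t ^ 2 / 2)) := by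
          rw [integral_mul_const]
          refine mul_le_mul_of_nonneg_right (hH.trans (le_of_eq ?_)) (Real.exp_nonneg _)
          simp [abs_of_nonneg hc]
      _ = _ := by
          rw [← Real.exp_add]
          congr 1
          push_cast
          ring

/-- **McDiarmid's inequality** on a finite product space. -/
theorem measureReal_ge_le_of_bounded_differences {n : ℕ} (μ : Fin n → Measure α)
    [∀ i, IsProbabilityMeasure (μ i)] {c : ℝ} (f : (Fin n → α) → ℝ)
    (hf : ∀ p i a b, f (Function.update p i a) - f (Function.update p i b) ≤ c)
    {ε : ℝ} (hε : 0 ≤ ε) :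
    (Measure.pi μ).real {p | ∫ q, f q ∂Measure.pi μ + ε ≤ f p} ≤
      Real.exp (-ε ^ 2 / (2 * (n * (c / 2) ^ 2))) := by
  have h : HasSubgaussianMGF (fun p => f p - ∫ q, f q ∂Measure.pi μ)
      (Real.toNNReal (n * (c / 2) ^ 2)) (Measure.pi μ) :=
    { integrable_exp_mul := fun t => Integrable.of_finite
      mgf_le := fun t => by
        refine (integral_exp_le_of_bounded_differences t μ f hf).trans (le_of_eq ?_)
        rw [Real.coe_toNNReal _ (by positivity)]
        congr 1
        ring }
  have := h.measure_ge_le hε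
  rw [Real.coe_toNNReal _ (by positivity)] at this
  refine le_trans (le_of_eq ?_) this
  congr 1 with p
  simp only [mem_ofPred_eq]
  constructor <;> intro h <;> linarith

end BoundedDifferences

/-! ### Sampling the predictions: expectation and tail -/

section Sampling

open ProbabilityTheory

/-- The distribution on `Fin n` with given weights. -/
def weightMeasure {n : ℕ} (w : Fin n → ℝ) : Measure (Fin n) :=
  ∑ i, ENNReal.ofReal (w i) • Measure.dirac i

lemma isProbabilityMeasure_weightMeasure {n : ℕ} {w : Fin n → ℝ} (hw : w ∈ stdSimplex ℝ (Fin n)) :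
    IsProbabilityMeasure (weightMeasure w) := by
  constructor
  simp only [weightMeasure, Measure.coe_finsetSum, Finset.sum_apply, Measure.smul_apply,
    measure_univ, smul_eq_mul, mul_one]
  rw [← ENNReal.ofReal_sum_of_nonneg fun i _ => hw.1 i, hw.2, ENNReal.ofReal_one]

lemma integral_weightMeasure {n : ℕ} {w : Fin n → ℝ} (hw : w ∈ stdSimplex ℝ (Fin n))
    (f : Fin n → ℝ) : ∫ i, f i ∂weightMeasure w = ∑ i, w i * f i := by
  rw [weightMeasure, integral_finsetSum_measure]
  · refine Finset.sum_congr rfl fun i _ => ?_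
    rw [integral_smul_measure, integral_dirac, ENNReal.toReal_ofReal (hw.1 i), smul_eq_mul]
  · intro i _
    exact (integrable_dirac (by simp)).smul_measure ENNReal.ofReal_ne_top

variable {T N d : ℕ} {x : ℕ → EuclideanSpace ℝ (Fin d)} (y : ℕ → Bool)
  {w : ℕ → Fin (N + 1) → ℝ}

lemma abs_labelValue_sub_gridPoint_le (b : Bool) (v : Fin (N + 1)) :
    |labelValue b - gridPoint N v| ≤ 1 := by
  have h := gridPoint_mem_Icc v
  cases b <;> simp only [labelValue, abs_le] <;> constructor <;> norm_num <;> linarith [h.1, h.2]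

/-- The mean of `bucketSum` when the prediction of round `t` has distribution `w t`. -/
def meanBucketSum (x : ℕ → EuclideanSpace ℝ (Fin d)) (y : ℕ → Bool) (w : ℕ → Fin (N + 1) → ℝ)
    (T : ℕ) (v : Fin (N + 1)) : EuclideanSpace ℝ (Fin d) :=
  ∑ t ∈ Finset.range T, (w t v * (labelValue (y t) - gridPoint N v)) • x t

/-- The rounds are independent, so the second moment of the deviation is a sum of variances. Round t
contributes at most w_t(v), as residual and context have norm at most 1; the dimension does not
enter, because the coordinate variances add up to a squared norm. -/
lemma integral_norm_bucketSum_sub_le (hx : ∀ t < T, ‖x t‖ ≤ 1)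
    (hw : ∀ t < T, w t ∈ stdSimplex ℝ (Fin (N + 1))) (v : Fin (N + 1)) :
    ∫ p, ‖bucketSum x y p v - meanBucketSum x y w T v‖
        ∂Measure.pi (fun t : Fin T => weightMeasure (w t)) ≤
      √(∑ t ∈ Finset.range T, w t v) := by
  have : ∀ t : Fin T, IsProbabilityMeasure (weightMeasure (w t)) :=
    fun t => isProbabilityMeasure_weightMeasure (hw t t.2)
  set P := Measure.pi (fun t : Fin T => weightMeasure (w t))
  set D : (Fin T → Fin (N + 1)) → EuclideanSpace ℝ (Fin d) :=
    fun p => bucketSum x y p v - meanBucketSum x y w T v with hD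
  set r : ℕ → ℝ := fun t => labelValue (y t) - gridPoint N v with hr
  -- the second moment is the sum of the variances of the coordinates
  let X : Fin d → Fin T → Fin (N + 1) → ℝ := fun i t a => if a = v then r t * x t i else 0
  have hmean : ∀ i (t : Fin T), ∫ a, X i t a ∂weightMeasure (w t) = w t v * (r t * x t i) := by
    intro i t
    rw [integral_weightMeasure (hw t t.2)]
    simp [X]
  have hcoord : ∀ i p, D p i = (∑ t, X i t (p t)) -
      ∫ q, (∑ t, fun q : Fin T → Fin (N + 1) => X i t (q t)) q ∂P := by
    intro i p
    have h1 : ∫ q, (∑ t, fun q : Fin T → Fin (N + 1) => X i t (q t)) q ∂P =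
        ∑ t : Fin T, w t v * (r t * x t i) := by
      simp only [Finset.sum_apply]
      rw [integral_finsetSum _ fun _ _ => Integrable.of_finite]
      refine Finset.sum_congr rfl fun t _ => ?_
      rw [← hmean]
      exact integral_comp_eval (μ := fun t : Fin T => weightMeasure (w t)) (i := t)
        (f := X i t) (measurable_of_finite _).aestronglyMeasurable
    rw [h1, hD]
    simp only [bucketSum, meanBucketSum, PiLp.sub_apply, WithLp.ofLp_sum, Finset.sum_apply, X]
    congr 1
    · refine Finset.sum_congr rfl fun t _ => ?_
      split_ifs <;> simp [r]
    · rw [Finset.sum_range]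
      refine Finset.sum_congr rfl fun t _ => ?_
      simp [r, mul_assoc]
  have hvar : ∀ i, ∫ p, D p i ^ 2 ∂P ≤ ∑ t : Fin T, w t v * x t i ^ 2 := by
    intro i
    have h1 : ∫ p, D p i ^ 2 ∂P =
        Var[∑ t, fun q : Fin T → Fin (N + 1) => X i t (q t); P] := by
      rw [variance_eq_integral (measurable_of_finite _).aemeasurable]
      congr 1 with p
      rw [hcoord]
      simp
    rw [h1, variance_sum_pi fun t => MemLp.of_discrete]
    refine Finset.sum_le_sum fun t _ => ?_
    refine (variance_le_expectation_sq (measurable_of_finite _).aestronglyMeasurable).trans ?_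
    rw [integral_weightMeasure (hw t t.2)]
    simp only [X, Pi.pow_apply]
    have h2 : ∀ a, w t a * (if a = v then r t * x t i else 0) ^ 2 =
        if a = v then w t v * (r t * x t i) ^ 2 else 0 := by
      intro a
      split_ifs with h
      · rw [h]
      · ring
    simp only [h2, Finset.sum_ite_eq', Finset.mem_univ, if_true]
    refine mul_le_mul_of_nonneg_left ?_ ((hw t t.2).1 v)
    have h3 : r t ^ 2 ≤ 1 := by
      rw [sq_le_one_iff_abs_le_one]
      exact abs_labelValue_sub_gridPoint_le _ _
    rw [mul_pow]
    exact mul_le_of_le_one_left (sq_nonneg _) h3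
  have hsecond : ∫ p, ‖D p‖ ^ 2 ∂P ≤ ∑ t ∈ Finset.range T, w t v := by
    calc ∫ p, ‖D p‖ ^ 2 ∂P = ∑ i, ∫ p, D p i ^ 2 ∂P := by
          rw [← integral_finsetSum _ fun _ _ => Integrable.of_finite]
          congr 1 with p
          rw [EuclideanSpace.real_norm_sq_eq]
      _ ≤ ∑ i, ∑ t : Fin T, w t v * x t i ^ 2 := Finset.sum_le_sum fun i _ => hvar i
      _ = ∑ t : Fin T, w t v * ‖x t‖ ^ 2 := by
          rw [Finset.sum_comm]
          refine Finset.sum_congr rfl fun t _ => ?_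
          rw [EuclideanSpace.real_norm_sq_eq, Finset.mul_sum]
      _ ≤ ∑ t : Fin T, w t v := by
          refine Finset.sum_le_sum fun t _ => ?_
          refine mul_le_of_le_one_right ((hw t t.2).1 v) ?_
          exact pow_le_one₀ (norm_nonneg _) (hx t t.2)
      _ = _ := (Finset.sum_range fun t => w t v).symm
  refine Real.le_sqrt_of_sq_le (le_trans ?_ hsecond)
  -- Nonnegativity of the variance is the inequality (E‖D‖)² ≤ E‖D‖².
  have h := variance_nonneg (fun p => ‖D p‖) P
  rw [variance_eq_sub MemLp.of_discrete] at h
  simpa using h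

/-- The sampled bucket sums exceed their means by `√((N + 1) T)` in expectation. -/
theorem integral_sum_norm_bucketSum_le (hx : ∀ t < T, ‖x t‖ ≤ 1)
    (hw : ∀ t < T, w t ∈ stdSimplex ℝ (Fin (N + 1))) :
    ∫ p, ∑ v, ‖bucketSum x y p v‖ ∂Measure.pi (fun t : Fin T => weightMeasure (w t)) ≤
      ∑ v, ‖meanBucketSum x y w T v‖ + √((N + 1) * T) := by
  have : ∀ t : Fin T, IsProbabilityMeasure (weightMeasure (w t)) :=
    fun t => isProbabilityMeasure_weightMeasure (hw t t.2)
  have h1 : ∀ v, ∫ p, ‖bucketSum x y p v‖ ∂Measure.pi (fun t : Fin T => weightMeasure (w t)) ≤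
      ‖meanBucketSum x y w T v‖ + √(∑ t ∈ Finset.range T, w t v) := by
    intro v
    calc _ ≤ ∫ p, (‖meanBucketSum x y w T v‖ + ‖bucketSum x y p v - meanBucketSum x y w T v‖)
          ∂Measure.pi (fun t : Fin T => weightMeasure (w t)) := by
          refine integral_mono Integrable.of_finite Integrable.of_finite fun p => ?_
          have := norm_add_le (meanBucketSum x y w T v)
            (bucketSum x y p v - meanBucketSum x y w T v)
          rwa [add_sub_cancel] at this
      _ ≤ _ := by
          rw [integral_add Integrable.of_finite Integrable.of_finite]
          simpa using integral_norm_bucketSum_sub_le y hx hw v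
  rw [integral_finsetSum _ fun _ _ => Integrable.of_finite]
  refine (Finset.sum_le_sum fun v _ => h1 v).trans ?_
  rw [Finset.sum_add_distrib]
  gcongr
  -- Cauchy–Schwarz over the N + 1 buckets, whose total mass over all rounds is T.
  refine Real.le_sqrt_of_sq_le (sq_sum_le_card_mul_sum_sq.trans ?_)
  have h2 : ∀ v : Fin (N + 1), √(∑ t ∈ Finset.range T, w t v) ^ 2 = ∑ t ∈ Finset.range T, w t v :=
    fun v => Real.sq_sqrt (Finset.sum_nonneg fun t ht => (hw t (Finset.mem_range.1 ht)).1 v)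
  simp only [h2]
  rw [Finset.sum_comm, Finset.sum_congr rfl fun t ht => (hw t (Finset.mem_range.1 ht)).2]
  simp

/-- Changing one draw removes a vector of norm at most 1 from one bucket and adds such a vector to
another. This is the bounded-differences constant for McDiarmid's inequality. -/
lemma sum_norm_bucketSum_update_sub_le (hx : ∀ t < T, ‖x t‖ ≤ 1) (p : Fin T → Fin (N + 1))
    (t : Fin T) (a b : Fin (N + 1)) :
    ∑ v, ‖bucketSum x y (Function.update p t a) v‖ -
      ∑ v, ‖bucketSum x y (Function.update p t b) v‖ ≤ 2 := by
  have hz : ∀ v : Fin (N + 1), ‖(labelValue (y t) - gridPoint N v) • x t‖ ≤ 1 := by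
    intro v
    rw [norm_smul]
    exact mul_le_one₀ (abs_labelValue_sub_gridPoint_le _ _) (norm_nonneg _) (hx t t.2)
  have h1 : ∀ v, ‖bucketSum x y (Function.update p t a) v‖ -
      ‖bucketSum x y (Function.update p t b) v‖ ≤
      (if a = v then (1 : ℝ) else 0) + if b = v then (1 : ℝ) else 0 := by
    intro v
    have h2 : ∀ c, bucketSum x y (Function.update p t c) v =
        (if c = v then (labelValue (y t) - gridPoint N v) • x t else 0) +
        ∑ s ∈ Finset.univ.erase t, if p s = v then (labelValue (y s) - gridPoint N v) • x s
          else 0 := by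
      intro c
      rw [bucketSum, ← Finset.add_sum_erase _ _ (Finset.mem_univ t), Function.update_self]
      congr 1
      refine Finset.sum_congr rfl fun s hs => ?_
      rw [Function.update_of_ne (Finset.ne_of_mem_erase hs)]
    refine (norm_sub_norm_le _ _).trans ?_
    rw [h2 a, h2 b, add_sub_add_right_eq_sub]
    refine (norm_sub_le _ _).trans (add_le_add ?_ ?_)
    · split_ifs
      exacts [hz v, by simp]
    · split_ifs
      exacts [hz v, by simp]
  rw [← Finset.sum_sub_distrib]
  refine (Finset.sum_le_sum fun v _ => h1 v).trans ?_
  rw [Finset.sum_add_distrib]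
  simp
  norm_num

/-- The trivial bound, which settles the regime where d log T is at least T. -/
lemma sum_norm_bucketSum_le (hx : ∀ t < T, ‖x t‖ ≤ 1) (p : Fin T → Fin (N + 1)) :
    ∑ v, ‖bucketSum x y p v‖ ≤ T := by
  calc _ ≤ ∑ v, ∑ t : Fin T, if p t = v then (1 : ℝ) else 0 := by
        refine Finset.sum_le_sum fun v _ => (norm_sum_le _ _).trans ?_
        refine Finset.sum_le_sum fun t _ => ?_
        split_ifs
        · rw [norm_smul]
          exact mul_le_one₀ (abs_labelValue_sub_gridPoint_le _ _) (norm_nonneg _) (hx t t.2)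
        · simp
    _ = T := by
        rw [Finset.sum_comm]
        simp

/-- With high probability the sampled bucket sums are close to their means. -/
theorem one_sub_le_measureReal_sum_norm_bucketSum (hT : 0 < T) (hx : ∀ t < T, ‖x t‖ ≤ 1)
    (hw : ∀ t < T, w t ∈ stdSimplex ℝ (Fin (N + 1))) {δ : ℝ} (hδ : 0 < δ) (hδ' : δ < 1) :
    1 - δ ≤ (Measure.pi (fun t : Fin T => weightMeasure (w t))).real
      {p | ∑ v, ‖bucketSum x y p v‖ ≤ ∑ v, ‖meanBucketSum x y w T v‖ + √((N + 1) * T) +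
        √(2 * T) * √(Real.log (1 / δ))} := by
  have : ∀ t : Fin T, IsProbabilityMeasure (weightMeasure (w t)) :=
    fun t => isProbabilityMeasure_weightMeasure (hw t t.2)
  have hlog : 0 ≤ Real.log (1 / δ) := Real.log_nonneg ((one_le_div hδ).2 hδ'.le)
  have hM := measureReal_ge_le_of_bounded_differences (fun t : Fin T => weightMeasure (w t))
    (fun p => ∑ v, ‖bucketSum x y p v‖) (c := 2) (sum_norm_bucketSum_update_sub_le y hx)
    (ε := √(2 * T) * √(Real.log (1 / δ))) (by positivity)
  -- The deviation is chosen so that, with differences 2, McDiarmid's tail is exactly δ.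
  have he : Real.exp (-(√(2 * T) * √(Real.log (1 / δ))) ^ 2 / (2 * (T * (2 / 2) ^ 2))) = δ := by
    rw [mul_pow, Real.sq_sqrt (by positivity), Real.sq_sqrt hlog]
    have hT' : (0 : ℝ) < T := by exact_mod_cast hT
    have : -(2 * T * Real.log (1 / δ)) / (2 * (T * (2 / 2 : ℝ) ^ 2)) = Real.log δ := by
      rw [one_div, Real.log_inv]
      field_simp
    rw [this, Real.exp_log hδ]
  rw [he] at hM
  have hc := probReal_compl_eq_one_sub (μ := Measure.pi (fun t : Fin T => weightMeasure (w t)))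
    (MeasurableSet.of_discrete (s := {p : Fin T → Fin (N + 1) |
      ∫ q, ∑ v, ‖bucketSum x y q v‖ ∂Measure.pi (fun t : Fin T => weightMeasure (w t)) +
        √(2 * T) * √(Real.log (1 / δ)) ≤ ∑ v, ‖bucketSum x y p v‖}))
  calc 1 - δ ≤ _ := sub_le_sub_left hM 1
    _ = _ := hc.symm
    _ ≤ _ := by
        refine measureReal_mono fun p hp => ?_
        have h1 := integral_sum_norm_bucketSum_le (N := N) y hx hw
        simp only [mem_compl_iff, mem_ofPred_eq, not_le] at hp
        rw [mem_ofPred_eq]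
        linarith

end Sampling

/-! ### Online ridge regression for the residuals of one bucket -/

section Ridge

open Matrix

variable {d : ℕ}

/-- The regularized Gram matrix `4 I + ∑ w a aᵀ`. -/
def gramMatrix (w : ℕ → ℝ) (a : ℕ → Fin d → ℝ) (t : ℕ) : Matrix (Fin d) (Fin d) ℝ :=
  (4 : ℝ) • (1 : Matrix (Fin d) (Fin d) ℝ) + ∑ s ∈ Finset.range t, w s • vecMulVec (a s) (a s)

/-- The weighted sum of the vectors `a`, with residuals `r`. -/
def residualSum (w r : ℕ → ℝ) (a : ℕ → Fin d → ℝ) (t : ℕ) : Fin d → ℝ :=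
  ∑ s ∈ Finset.range t, (w s * r s) • a s

/-- The prediction of the residual of round `t` by ridge regression. -/
def ridgePrediction (w r : ℕ → ℝ) (a : ℕ → Fin d → ℝ) (t : ℕ) : ℝ :=
  ((gramMatrix w a t)⁻¹ *ᵥ a t) ⬝ᵥ residualSum w r a t

/-- The leverage of the vector of round `t`. -/
def leverage (w : ℕ → ℝ) (a : ℕ → Fin d → ℝ) (t : ℕ) : ℝ :=
  a t ⬝ᵥ ((gramMatrix w a t)⁻¹ *ᵥ a t)

/-- The squared norm of the residual sum in the metric of the inverse Gram matrix. -/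
def ridgePotential (w r : ℕ → ℝ) (a : ℕ → Fin d → ℝ) (t : ℕ) : ℝ :=
  residualSum w r a t ⬝ᵥ ((gramMatrix w a t)⁻¹ *ᵥ residualSum w r a t)

/-- The **Sherman–Morrison formula**. -/
lemma inv_add_smul_vecMulVec {A : Matrix (Fin d) (Fin d) ℝ} (hA : IsUnit A.det) (hs : A⁻¹ᵀ = A⁻¹) {w : ℝ}
    {a : Fin d → ℝ} (h : 1 + w * (a ⬝ᵥ (A⁻¹ *ᵥ a)) ≠ 0) :
    (A + w • vecMulVec a a)⁻¹ =
      A⁻¹ - (w / (1 + w * (a ⬝ᵥ (A⁻¹ *ᵥ a)))) • vecMulVec (A⁻¹ *ᵥ a) (A⁻¹ *ᵥ a) := by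
  refine Matrix.inv_eq_right_inv ?_
  have h1 : A * vecMulVec (A⁻¹ *ᵥ a) (A⁻¹ *ᵥ a) = vecMulVec a (A⁻¹ *ᵥ a) := by
    rw [mul_vecMulVec, mulVec_mulVec, Matrix.mul_nonsing_inv _ hA, one_mulVec]
  have h2 : vecMulVec a a * A⁻¹ = vecMulVec a (A⁻¹ *ᵥ a) := by
    rw [vecMulVec_mul, ← mulVec_transpose, hs]
  have h3 : vecMulVec a a * vecMulVec (A⁻¹ *ᵥ a) (A⁻¹ *ᵥ a) =
      (a ⬝ᵥ (A⁻¹ *ᵥ a)) • vecMulVec a (A⁻¹ *ᵥ a) := by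
    rw [vecMulVec_mul_vecMulVec, vecMulVec_smul]
  rw [add_mul, mul_sub, mul_sub, Matrix.mul_nonsing_inv _ hA, Matrix.mul_smul, Matrix.mul_smul,
    Matrix.smul_mul, Matrix.smul_mul, h1, h2, h3, smul_smul, smul_smul]
  have h4 : w - w / (1 + w * (a ⬝ᵥ (A⁻¹ *ᵥ a))) -
      w / (1 + w * (a ⬝ᵥ (A⁻¹ *ᵥ a))) * w * (a ⬝ᵥ (A⁻¹ *ᵥ a)) = 0 := by
    field_simp
    ring
  generalize vecMulVec a (A⁻¹ *ᵥ a) = V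
  generalize a ⬝ᵥ (A⁻¹ *ᵥ a) = c at *
  have h5 : w • V - (w / (1 + w * c)) • V - (w / (1 + w * c) * w * c) • V = 0 := by
    rw [← sub_smul, ← sub_smul, h4, zero_smul]
  have : (1 : Matrix (Fin d) (Fin d) ℝ) - (w / (1 + w * c)) • V +
      (w • V - (w / (1 + w * c) * (w * c)) • V) =
      1 + (w • V - (w / (1 + w * c)) • V - (w / (1 + w * c) * w * c) • V) := by
    rw [← mul_assoc]
    abel
  rw [h5, add_zero] at this
  rwa [mul_assoc]

variable {w r : ℕ → ℝ} {a : ℕ → Fin d → ℝ} {T : ℕ}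

lemma gramMatrix_succ (t : ℕ) :
    gramMatrix w a (t + 1) = gramMatrix w a t + w t • vecMulVec (a t) (a t) := by
  rw [gramMatrix, Finset.sum_range_succ, ← add_assoc, gramMatrix]

lemma residualSum_succ (t : ℕ) :
    residualSum w r a (t + 1) = residualSum w r a t + (w t * r t) • a t := by
  rw [residualSum, Finset.sum_range_succ, residualSum]

lemma dotProduct_gramMatrix_mulVec (t : ℕ) (v u : Fin d → ℝ) :
    v ⬝ᵥ (gramMatrix w a t *ᵥ u) =
      4 * (v ⬝ᵥ u) + ∑ s ∈ Finset.range t, w s * ((a s ⬝ᵥ v) * (a s ⬝ᵥ u)) := by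
  rw [gramMatrix, add_mulVec, smul_mulVec, one_mulVec, sum_mulVec, dotProduct_add,
    dotProduct_smul, smul_eq_mul, dotProduct_sum]
  congr 1
  refine Finset.sum_congr rfl fun s _ => ?_
  rw [smul_mulVec, vecMulVec_mulVec, dotProduct_smul, op_smul_eq_smul, dotProduct_smul,
    dotProduct_comm v, smul_eq_mul, smul_eq_mul]
  ring

lemma transpose_gramMatrix (t : ℕ) : (gramMatrix w a t)ᵀ = gramMatrix w a t := by
  simp [gramMatrix, transpose_sum, transpose_vecMulVec]

lemma transpose_inv_gramMatrix (t : ℕ) : (gramMatrix w a t)⁻¹ᵀ = (gramMatrix w a t)⁻¹ := by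
  rw [transpose_nonsing_inv, transpose_gramMatrix]

lemma four_mul_le_dotProduct_gramMatrix (t : ℕ) (hw : ∀ s < t, 0 ≤ w s) (v : Fin d → ℝ) :
    4 * (v ⬝ᵥ v) ≤ v ⬝ᵥ (gramMatrix w a t *ᵥ v) := by
  rw [dotProduct_gramMatrix_mulVec]
  have : 0 ≤ ∑ s ∈ Finset.range t, w s * ((a s ⬝ᵥ v) * (a s ⬝ᵥ v)) :=
    Finset.sum_nonneg fun s hs => mul_nonneg (hw s (Finset.mem_range.1 hs)) (mul_self_nonneg _)
  linarith

lemma posDef_gramMatrix (t : ℕ) (hw : ∀ s < t, 0 ≤ w s) : (gramMatrix w a t).PosDef := by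
  refine PosDef.of_dotProduct_mulVec_pos ?_ fun v hv => ?_
  · rw [IsHermitian, conjTranspose_eq_transpose_of_trivial, transpose_gramMatrix]
  · rw [star_trivial]
    have h1 := four_mul_le_dotProduct_gramMatrix (a := a) t hw v
    have h2 : 0 < v ⬝ᵥ v := by
      simpa using (dotProduct_star_self_pos_iff (v := v)).2 hv
    linarith

lemma isUnit_det_gramMatrix (t : ℕ) (hw : ∀ s < t, 0 ≤ w s) :
    IsUnit (gramMatrix w a t).det :=
  (posDef_gramMatrix t hw).det_pos.ne'.isUnit

lemma sq_dotProduct_le (u v : Fin d → ℝ) : (u ⬝ᵥ v) ^ 2 ≤ (u ⬝ᵥ u) * (v ⬝ᵥ v) := by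
  simpa only [dotProduct, ← sq] using Finset.sum_mul_sq_le_sq_mul_sq Finset.univ u v

lemma dotProduct_self_nonneg' (u : Fin d → ℝ) : 0 ≤ u ⬝ᵥ u :=
  Finset.sum_nonneg fun i _ => mul_self_nonneg (u i)

/-- With z = A⁻¹a and h = a · z, the bound A ≥ 4 I gives h = z · Az ≥ 4 |z|², while Cauchy–Schwarz
gives h² ≤ |z|²; hence h ≤ 1/4. The regularization 4 is there to make the leverage this small. -/
lemma leverage_mem_Icc (t : ℕ) (hw : ∀ s < t, 0 ≤ w s) (ha : a t ⬝ᵥ a t ≤ 1) :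
    leverage w a t ∈ Icc (0 : ℝ) (1 / 4) := by
  set z := (gramMatrix w a t)⁻¹ *ᵥ a t with hz
  have h1 : gramMatrix w a t *ᵥ z = a t := by
    rw [hz, mulVec_mulVec, Matrix.mul_nonsing_inv _ (isUnit_det_gramMatrix t hw), one_mulVec]
  have h2 := four_mul_le_dotProduct_gramMatrix (a := a) t hw z
  rw [h1, dotProduct_comm z (a t)] at h2
  have h3 := sq_dotProduct_le (a t) z
  have h4 := dotProduct_self_nonneg' z
  have h5 : leverage w a t = a t ⬝ᵥ z := rfl
  rw [h5]
  constructor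
  · linarith
  · nlinarith

lemma inv_gramMatrix_succ (t : ℕ) (hw : ∀ s < t + 1, 0 ≤ w s) (ha : a t ⬝ᵥ a t ≤ 1) :
    (gramMatrix w a (t + 1))⁻¹ = (gramMatrix w a t)⁻¹ - (w t / (1 + w t * leverage w a t)) •
      vecMulVec ((gramMatrix w a t)⁻¹ *ᵥ a t) ((gramMatrix w a t)⁻¹ *ᵥ a t) := by
  rw [gramMatrix_succ]
  have h := leverage_mem_Icc t (fun s hs => hw s (by omega)) ha
  have h2 := mul_nonneg (hw t (by omega)) h.1
  exact inv_add_smul_vecMulVec (isUnit_det_gramMatrix t fun s hs => hw s (by omega))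
    (transpose_inv_gramMatrix t) (by change 1 + w t * leverage w a t ≠ 0; positivity)

/-- Sherman–Morrison gives the exact increment w r² - w (r - u)²/(1 + w h). The excess over w (2 r u
- u²) is w (r - u)² q with q = w h/(1 + w h). Bounding (r - u)² by 2 + 2 u² leaves 2q, which is
summable, and 2 w u² q, which costs half of the negative term -w u² because q ≤ 1/4. The surviving
-u²/2 is needed by the defensive forecast. -/
lemma ridgePotential_succ_le (t : ℕ) (hw : ∀ s < t + 1, 0 ≤ w s) (hw1 : w t ≤ 1)
    (hr : |r t| ≤ 1) (ha : a t ⬝ᵥ a t ≤ 1) :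
    ridgePotential w r a (t + 1) ≤ ridgePotential w r a t +
      w t * (2 * r t * ridgePrediction w r a t - ridgePrediction w r a t ^ 2 / 2) +
      2 * (w t * leverage w a t / (1 + w t * leverage w a t)) := by
  have hlev := leverage_mem_Icc t (fun s hs => hw s (by omega)) ha
  have hwt := hw t (by omega)
  have hc := mul_nonneg hwt hlev.1
  have hsym : a t ⬝ᵥ ((gramMatrix w a t)⁻¹ *ᵥ residualSum w r a t) = ridgePrediction w r a t := by
    rw [dotProduct_mulVec, ← mulVec_transpose, transpose_inv_gramMatrix, ridgePrediction]
  have hu : residualSum w r a t ⬝ᵥ ((gramMatrix w a t)⁻¹ *ᵥ a t) = ridgePrediction w r a t := by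
    rw [ridgePrediction, dotProduct_comm]
  have hstep : ridgePotential w r a (t + 1) = ridgePotential w r a t + w t * r t ^ 2 -
      w t * (r t - ridgePrediction w r a t) ^ 2 / (1 + w t * leverage w a t) := by
    have h1 : ((gramMatrix w a t)⁻¹ *ᵥ a t) ⬝ᵥ residualSum w r a (t + 1) =
        ridgePrediction w r a t + w t * r t * leverage w a t := by
      rw [residualSum_succ, dotProduct_add, dotProduct_smul, smul_eq_mul, ridgePrediction,
        leverage, dotProduct_comm (a t)]
    have h2 : residualSum w r a (t + 1) ⬝ᵥ ((gramMatrix w a t)⁻¹ *ᵥ residualSum w r a (t + 1)) =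
        ridgePotential w r a t + 2 * (w t * r t) * ridgePrediction w r a t +
          (w t * r t) ^ 2 * leverage w a t := by
      rw [residualSum_succ, mulVec_add, mulVec_smul, dotProduct_add, add_dotProduct,
        add_dotProduct, dotProduct_smul, dotProduct_smul, smul_dotProduct, smul_dotProduct, hu,
        hsym, ridgePotential, leverage]
      simp only [smul_eq_mul]
      ring
    rw [ridgePotential, inv_gramMatrix_succ t hw ha, sub_mulVec, smul_mulVec, vecMulVec_mulVec,
      op_smul_eq_smul, dotProduct_sub, h2, dotProduct_smul, dotProduct_smul,
      dotProduct_comm (residualSum w r a (t + 1)) (_ *ᵥ a t), h1, smul_eq_mul, smul_eq_mul]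
    field_simp
    ring
  rw [hstep]
  set u := ridgePrediction w r a t
  set h := leverage w a t
  have hr2 : r t ^ 2 ≤ 1 := (sq_le_one_iff_abs_le_one _).2 hr
  have hpos : 0 < 1 + w t * h := by positivity
  have e : w t * r t ^ 2 - w t * (r t - u) ^ 2 / (1 + w t * h) =
      w t * (r t ^ 2 - (r t - u) ^ 2) + w t * (r t - u) ^ 2 * (w t * h / (1 + w t * h)) := by
    field_simp
    ring
  set q := w t * h / (1 + w t * h)
  have hq0 : 0 ≤ q := by positivity
  have hq1 : q ≤ 1 / 4 := by
    rw [div_le_iff₀ hpos]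
    nlinarith [hlev.2, hlev.1]
  have h1 : (r t - u) ^ 2 ≤ 2 + 2 * u ^ 2 := by nlinarith [sq_nonneg (r t + u)]
  have h2 : w t * (r t - u) ^ 2 * q ≤ w t * (2 + 2 * u ^ 2) * q := by gcongr
  have h3 : w t * u ^ 2 * q ≤ w t * u ^ 2 * (1 / 4) := by gcongr
  have h4 : w t * q ≤ q := mul_le_of_le_one_left hq0 hw1
  rw [add_sub_assoc, e]
  nlinarith

/-- The matrix determinant lemma for a rank-one update; it makes the logarithm of the determinant
telescope. -/
lemma det_gramMatrix_succ (t : ℕ) (hw : ∀ s < t, 0 ≤ w s) :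
    (gramMatrix w a (t + 1)).det = (gramMatrix w a t).det * (1 + w t * leverage w a t) := by
  rw [gramMatrix_succ, ← smul_vecMulVec, vecMulVec_eq Unit,
    det_add_replicateCol_mul_replicateRow (isUnit_det_gramMatrix t hw)]
  congr 1
  rw [det_unique, Matrix.add_apply, one_apply_eq, Matrix.mul_assoc, ← replicateCol_mulVec,
    replicateRow_mul_replicateCol_apply, mulVec_smul, dotProduct_smul, leverage, smul_eq_mul]

/-- The elliptical potential lemma. -/
lemma sum_leverage_le (T : ℕ) (hw : ∀ t < T, 0 ≤ w t) (hw1 : ∀ t < T, w t ≤ 1)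
    (ha : ∀ t < T, a t ⬝ᵥ a t ≤ 1) :
    ∑ t ∈ Finset.range T, w t * leverage w a t / (1 + w t * leverage w a t) ≤
      d * Real.log (4 * d + T) := by
  have h1 : ∀ n ≤ T, ∑ t ∈ Finset.range n, w t * leverage w a t / (1 + w t * leverage w a t) ≤
      Real.log (gramMatrix w a n).det - Real.log (gramMatrix w a 0).det := by
    intro n hn
    induction n with
    | zero => simp
    | succ n ih =>
      have hw' : ∀ s < n, 0 ≤ w s := fun s hs => hw s (by omega)
      have hlev := mul_nonneg (hw n (by omega)) (leverage_mem_Icc n hw' (ha n (by omega))).1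
      rw [Finset.sum_range_succ, det_gramMatrix_succ n hw',
        Real.log_mul (posDef_gramMatrix n hw').det_pos.ne' (by positivity)]
      -- The summand is 1 - 1/z with z = 1 + w h, hence at most log z, the increment of the
      -- log-determinant.
      have h2 := Real.one_sub_inv_le_log_of_pos (x := 1 + w n * leverage w a n) (by positivity)
      have h3 : w n * leverage w a n / (1 + w n * leverage w a n) =
          1 - (1 + w n * leverage w a n)⁻¹ := by
        field_simp
        ring
      linarith [ih (by omega)]
  have h0 : 0 ≤ Real.log (gramMatrix w a 0).det := by
    refine Real.log_nonneg ?_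
    simp only [gramMatrix, Finset.range_zero, Finset.sum_empty, add_zero, det_smul, det_one,
      mul_one]
    exact one_le_pow₀ (by norm_num)
  have hP := posDef_gramMatrix (a := a) T hw
  have htr : (gramMatrix w a T).trace ≤ 4 * d + T := by
    rw [gramMatrix, trace_add, trace_smul, trace_one, trace_sum, smul_eq_mul, Fintype.card_fin]
    gcongr
    calc _ ≤ ∑ t ∈ Finset.range T, (1 : ℝ) := by
          refine Finset.sum_le_sum fun t ht => ?_
          rw [trace_smul, trace_vecMulVec, smul_eq_mul]
          exact mul_le_one₀ (hw1 t (Finset.mem_range.1 ht)) (dotProduct_self_nonneg' _)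
            (ha t (Finset.mem_range.1 ht))
      _ = T := by simp
  -- Each eigenvalue is bounded by the trace. Omitting the factor 1/d of the arithmetic–geometric
  -- mean only affects the argument of the logarithm.
  have hdet : (gramMatrix w a T).det ≤ (4 * d + T) ^ d := by
    rw [hP.1.det_eq_prod_eigenvalues]
    calc _ ≤ ∏ _ : Fin d, (4 * (d : ℝ) + T) := by
          refine Finset.prod_le_prod (fun i _ => (hP.eigenvalues_pos i).le) fun i _ => ?_
          refine le_trans ?_ htr
          rw [hP.1.trace_eq_sum_eigenvalues]
          exact Finset.single_le_sum (f := fun i => hP.1.eigenvalues i)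
            (fun i _ => (hP.eigenvalues_pos i).le) (Finset.mem_univ i)
      _ = _ := by simp
  have h5 := Real.log_le_log hP.det_pos hdet
  rw [Real.log_pow] at h5
  linarith [h1 T le_rfl]

/-- The residual sums of ridge regression are controlled by the cumulative loss of its
predictions of the residuals. -/
theorem dotProduct_residualSum_le (T : ℕ) (hw : ∀ t < T, 0 ≤ w t) (hw1 : ∀ t < T, w t ≤ 1)
    (hr : ∀ t < T, |r t| ≤ 1) (ha : ∀ t < T, a t ⬝ᵥ a t ≤ 1) :
    residualSum w r a T ⬝ᵥ residualSum w r a T ≤ (4 + ∑ t ∈ Finset.range T, w t) *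
      (∑ t ∈ Finset.range T,
        w t * (2 * r t * ridgePrediction w r a t - ridgePrediction w r a t ^ 2 / 2) +
        2 * (d * Real.log (4 * d + T))) := by
  have hpot : ∀ n ≤ T, ridgePotential w r a n ≤ ∑ t ∈ Finset.range n,
      (w t * (2 * r t * ridgePrediction w r a t - ridgePrediction w r a t ^ 2 / 2) +
      2 * (w t * leverage w a t / (1 + w t * leverage w a t))) := by
    intro n hn
    induction n with
    | zero => simp [ridgePotential, residualSum]
    | succ n ih =>
      rw [Finset.sum_range_succ]
      have := ridgePotential_succ_le (w := w) (r := r) (a := a) n (fun s hs => hw s (by omega))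
        (hw1 n (by omega)) (hr n (by omega)) (ha n (by omega))
      linarith [ih (by omega)]
  have hQ := hpot T le_rfl
  rw [Finset.sum_add_distrib, ← Finset.mul_sum] at hQ
  have hlev := sum_leverage_le T hw hw1 ha
  have hW : 0 ≤ ∑ t ∈ Finset.range T, w t :=
    Finset.sum_nonneg fun t ht => hw t (Finset.mem_range.1 ht)
  refine le_trans ?_ (mul_le_mul_of_nonneg_left (hQ.trans (by linarith)) (by linarith))
  -- compare the potential with the squared norm
  set B := residualSum w r a T
  set z := (gramMatrix w a T)⁻¹ *ᵥ B with hz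
  set c := 4 + ∑ t ∈ Finset.range T, w t with hc
  have hAz : gramMatrix w a T *ᵥ z = B := by
    rw [hz, mulVec_mulVec, Matrix.mul_nonsing_inv _ (isUnit_det_gramMatrix T hw), one_mulVec]
  have hup : B ⬝ᵥ (gramMatrix w a T *ᵥ B) ≤ c * (B ⬝ᵥ B) := by
    rw [dotProduct_gramMatrix_mulVec, hc, add_mul, Finset.sum_mul]
    gcongr with t ht
    · exact hw t (Finset.mem_range.1 ht)
    · rw [← sq]
      refine (sq_dotProduct_le _ _).trans ?_
      exact mul_le_of_le_one_left (dotProduct_self_nonneg' _) (ha t (Finset.mem_range.1 ht))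
  have hcpos : 0 < c := by linarith
  -- All eigenvalues of the Gram matrix A are at most c, so its inverse should dominate c⁻¹ I. This
  -- is obtained without spectral theory by expanding the quadratic form of A at A⁻¹B - c⁻¹B, which
  -- is nonnegative.
  have hnn := four_mul_le_dotProduct_gramMatrix (a := a) T hw (z - c⁻¹ • B)
  have h1 := dotProduct_self_nonneg' (z - c⁻¹ • B)
  have hzB : z ⬝ᵥ (gramMatrix w a T *ᵥ B) = B ⬝ᵥ B := by
    rw [dotProduct_mulVec, ← mulVec_transpose, transpose_gramMatrix, hAz]
  have hexp : (z - c⁻¹ • B) ⬝ᵥ (gramMatrix w a T *ᵥ (z - c⁻¹ • B)) =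
      z ⬝ᵥ B - 2 * c⁻¹ * (B ⬝ᵥ B) + c⁻¹ ^ 2 * (B ⬝ᵥ (gramMatrix w a T *ᵥ B)) := by
    simp only [mulVec_sub, mulVec_smul, hAz, sub_dotProduct, dotProduct_sub, smul_dotProduct,
      dotProduct_smul, hzB, smul_eq_mul]
    ring
  rw [hexp] at hnn
  have h2 : c⁻¹ ^ 2 * (B ⬝ᵥ (gramMatrix w a T *ᵥ B)) ≤ c⁻¹ ^ 2 * (c * (B ⬝ᵥ B)) := by gcongr
  have h3 : c⁻¹ ^ 2 * (c * (B ⬝ᵥ B)) = c⁻¹ * (B ⬝ᵥ B) := by field_simp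
  have h4 : c⁻¹ * (B ⬝ᵥ B) ≤ z ⬝ᵥ B := by linarith
  have h5 : ridgePotential w r a T = z ⬝ᵥ B := by rw [ridgePotential, dotProduct_comm]
  rw [h5]
  rwa [inv_mul_le_iff₀ hcpos] at h4

end Ridge

/-! ### Defensive forecasting on the grid -/

section Defensive

/-- The forecast on the grid `{0, …, N}` that makes the correlation with `u` vanish: `j` is a
position where `u` changes its sign. -/
def defensiveWeights (N : ℕ) (u : ℕ → ℝ) (j i : ℕ) : ℝ :=
  if j = 0 then if i = 0 then 1 else 0
  else if N < j then if i = N then 1 else 0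
  else if i = j - 1 then -u j / (u (j - 1) - u j)
  else if i = j then u (j - 1) / (u (j - 1) - u j) else 0

/-- `j` is a position after which `u` is nonpositive, and `u` is positive just before. -/
def IsSignChange (N : ℕ) (u : ℕ → ℝ) (j : ℕ) : Prop :=
  j ≤ N + 1 ∧ (0 < j → 0 < u (j - 1)) ∧ ∀ i, j ≤ i → i ≤ N → u i ≤ 0

variable {N : ℕ} {u : ℕ → ℝ} {j : ℕ}

lemma sum_defensiveWeights (F : ℕ → ℝ) :
    ∑ i ∈ Finset.range (N + 1), defensiveWeights N u j i * F i =
      if j = 0 then F 0 else if N < j then F N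
      else -u j / (u (j - 1) - u j) * F (j - 1) + u (j - 1) / (u (j - 1) - u j) * F j := by
  unfold defensiveWeights
  split_ifs with h1 h2
  · simp
  · simp
  · have h3 : ∀ i, (if i = j - 1 then -u j / (u (j - 1) - u j)
        else if i = j then u (j - 1) / (u (j - 1) - u j) else 0) * F i =
        (if i = j - 1 then -u j / (u (j - 1) - u j) * F (j - 1) else 0) +
        (if i = j then u (j - 1) / (u (j - 1) - u j) * F j else 0) := by
      intro i
      by_cases e1 : i = j - 1
      · have e2 : i ≠ j := by omega
        simp [e1, show j - 1 ≠ j by omega]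
      · by_cases e2 : i = j
        · simp [e2, show j ≠ j - 1 by omega]
        · simp [e1, e2]
    rw [Finset.sum_congr rfl fun i _ => h3 i, Finset.sum_add_distrib]
    simp only [Finset.sum_ite_eq', Finset.mem_range]
    rw [if_pos (by omega), if_pos (by omega)]

lemma defensiveWeights_nonneg (h : IsSignChange N u j) (i : ℕ) :
    0 ≤ defensiveWeights N u j i := by
  unfold defensiveWeights
  split_ifs with h1 h2
  all_goals first | positivity | skip
  all_goals
    have h3 := h.2.1 (by omega)
    have h4 := h.2.2 j le_rfl (by omega)
    have h5 : 0 < u (j - 1) - u j := by linarith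
  · exact div_nonneg (by linarith) h5.le
  · exact div_nonneg h3.le h5.le

lemma sum_defensiveWeights_eq_one (h : IsSignChange N u j) :
    ∑ i ∈ Finset.range (N + 1), defensiveWeights N u j i = 1 := by
  have := sum_defensiveWeights (N := N) (u := u) (j := j) fun _ => 1
  simp only [mul_one] at this
  rw [this]
  split_ifs with h1 h2
  · rfl
  · rfl
  · have h3 := h.2.1 (by omega)
    have h4 := h.2.2 j le_rfl (by omega)
    have h5 : u (j - 1) - u j ≠ 0 := by linarith
    field_simp
    ring

/-- At an interior sign change the mean of u is zero, so the label cancels and the linear part is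
2c/N, with c the common value of weight times |u| at the two points. Since c is at most both |u|
values, the quadratic part is at most -c², and c (2/N - c) ≤ 1/N². If u has no interior sign change,
predicting the endpoint 0 or 1 makes the linear term nonpositive for both labels. -/
lemma sum_defensiveWeights_mul_le (hN : 1 ≤ N) (h : IsSignChange N u j) (b : Bool) :
    ∑ i ∈ Finset.range (N + 1), defensiveWeights N u j i *
      (2 * (labelValue b - (i : ℝ) / N) * u i - u i ^ 2 / 2) ≤ 1 / (N : ℝ) ^ 2 := by
  have hN' : (0 : ℝ) < N := by exact_mod_cast hN
  have hb : 0 ≤ labelValue b ∧ labelValue b ≤ 1 := by cases b <;> simp [labelValue]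
  rw [sum_defensiveWeights]
  have hpos : 0 ≤ 1 / (N : ℝ) ^ 2 := by positivity
  split_ifs with h1 h2
  · have h3 := h.2.2 0 h1.le (by omega)
    simp only [Nat.cast_zero, zero_div, sub_zero]
    nlinarith [mul_nonneg hb.1 (neg_nonneg.2 h3), sq_nonneg (u 0)]
  · have h3 := h.2.1 (by omega)
    have : j - 1 = N := by have := h.1; omega
    rw [this] at h3
    rw [div_self hN'.ne']
    nlinarith [mul_nonneg (sub_nonneg.2 hb.2) h3.le, sq_nonneg (u N)]
  · have h3 := h.2.1 (by omega)
    have h4 := h.2.2 j le_rfl (by omega)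
    obtain ⟨m, rfl⟩ : ∃ m, j = m + 1 := ⟨j - 1, by omega⟩
    simp only [Nat.add_sub_cancel] at *
    set p := u m
    set q := u (m + 1)
    have h5 : 0 < p - q := by linarith
    -- the common first-order term
    set c := -q * p / (p - q) with hc
    have hc0 : 0 ≤ c := div_nonneg (mul_nonneg (by linarith) h3.le) h5.le
    have hcp : c ≤ p := by
      rw [hc, div_le_iff₀ h5]; nlinarith
    have hcq : c ≤ -q := by
      rw [hc, div_le_iff₀ h5]; nlinarith
    have e : -q / (p - q) * (2 * (labelValue b - (m : ℝ) / N) * p - p ^ 2 / 2) +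
        p / (p - q) * (2 * (labelValue b - ((m + 1 : ℕ) : ℝ) / N) * q - q ^ 2 / 2) =
        c * (2 / N - p / 2 + q / 2) := by
      rw [hc]
      push_cast
      field_simp
      ring
    rw [e]
    have h6 : c * (2 / N - p / 2 + q / 2) ≤ c * (2 / N - c) :=
      mul_le_mul_of_nonneg_left (by linarith) hc0
    have h7 : 1 / (N : ℝ) ^ 2 = (1 / N) ^ 2 := by rw [div_pow, one_pow]
    have h8 : (2 : ℝ) / N = 2 * (1 / N) := by ring
    rw [h7]
    rw [h8] at h6 ⊢
    nlinarith [sq_nonneg (1 / (N : ℝ) - c)]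

end Defensive

/-! ### Ridge regression and defensive forecasting combined over the buckets -/

/-- The ridge prediction of the residual in bucket `v`. -/
def bucketPrediction {N d : ℕ} (x : ℕ → EuclideanSpace ℝ (Fin d)) (y : ℕ → Bool)
    (w : ℕ → Fin (N + 1) → ℝ) (t : ℕ) (v : Fin (N + 1)) : ℝ :=
  ridgePrediction (fun t => w t v) (fun t => labelValue (y t) - gridPoint N v)
    (fun t => (x t).ofLp) t

lemma dotProduct_ofLp {d : ℕ} (x : EuclideanSpace ℝ (Fin d)) : x.ofLp ⬝ᵥ x.ofLp = ‖x‖ ^ 2 := by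
  rw [EuclideanSpace.real_norm_sq_eq]
  exact Finset.sum_congr rfl fun i _ => (sq _).symm

lemma ofLp_meanBucketSum {N d : ℕ} (x : ℕ → EuclideanSpace ℝ (Fin d)) (y : ℕ → Bool)
    (w : ℕ → Fin (N + 1) → ℝ) (T : ℕ) (v : Fin (N + 1)) :
    (meanBucketSum x y w T v).ofLp = residualSum (fun t => w t v)
      (fun t => labelValue (y t) - gridPoint N v) (fun t => (x t).ofLp) T := by
  rw [meanBucketSum, residualSum, WithLp.ofLp_sum]
  rfl

/-- If the forecasts are nearly uncorrelated with the ridge predictions of the residuals, then the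
residuals are nearly uncorrelated with the contexts in all buckets. -/
theorem sum_norm_meanBucketSum_le {N d T : ℕ} {x : ℕ → EuclideanSpace ℝ (Fin d)}
    {y : ℕ → Bool} {w : ℕ → Fin (N + 1) → ℝ} (hx : ∀ t < T, ‖x t‖ ≤ 1)
    (hw : ∀ t < T, w t ∈ stdSimplex ℝ (Fin (N + 1))) {ε : ℝ}
    (hdef : ∀ t < T, ∑ v, w t v * (2 * (labelValue (y t) - gridPoint N v) *
      bucketPrediction x y w t v - bucketPrediction x y w t v ^ 2 / 2) ≤ ε) :
    ∑ v, ‖meanBucketSum x y w T v‖ ≤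
      √((4 * (N + 1) + T) * (T * ε + 2 * (N + 1) * (d * Real.log (4 * d + T)))) := by
  set L : ℝ := 2 * (d * Real.log (4 * d + T)) with hL
  set g : Fin (N + 1) → ℝ := fun v => ∑ t ∈ Finset.range T,
    w t v * (2 * (labelValue (y t) - gridPoint N v) *
      bucketPrediction x y w t v - bucketPrediction x y w t v ^ 2 / 2) with hg
  set n : Fin (N + 1) → ℝ := fun v => ∑ t ∈ Finset.range T, w t v with hn
  have hw1 : ∀ t < T, ∀ v, w t v ≤ 1 := fun t ht v => by
    rw [← (hw t ht).2]
    exact Finset.single_le_sum (fun i _ => (hw t ht).1 i) (Finset.mem_univ v)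
  have hn0 : ∀ v, 0 ≤ n v := fun v =>
    Finset.sum_nonneg fun t ht => (hw t (Finset.mem_range.1 ht)).1 v
  have hbound : ∀ v, ‖meanBucketSum x y w T v‖ ^ 2 ≤ (4 + n v) * (g v + L) := by
    intro v
    rw [← dotProduct_ofLp, ofLp_meanBucketSum]
    refine dotProduct_residualSum_le T (fun t ht => (hw t ht).1 v) (fun t ht => hw1 t ht v)
      (fun t _ => abs_labelValue_sub_gridPoint_le _ _) fun t ht => ?_
    rw [dotProduct_ofLp]
    exact pow_le_one₀ (norm_nonneg _) (hx t ht)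
  -- `g v` alone may be negative, but the ridge bound forces g v + L to be nonnegative, so the
  -- square root of the product splits.
  have hgL : ∀ v, 0 ≤ g v + L := fun v =>
    nonneg_of_mul_nonneg_right ((sq_nonneg _).trans (hbound v)) (by linarith [hn0 v])
  have h1 : ∀ v, ‖meanBucketSum x y w T v‖ ≤ √(4 + n v) * √(g v + L) := by
    intro v
    rw [← Real.sqrt_mul (by linarith [hn0 v])]
    exact Real.le_sqrt_of_sq_le (hbound v)
  refine (Finset.sum_le_sum fun v _ => h1 v).trans ?_
  -- After Cauchy–Schwarz over the buckets, both factors are evaluated by exchanging sums: each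
  -- forecast has mass 1, and `hdef` holds only for the sum over all buckets in a round.
  refine Real.le_sqrt_of_sq_le ((Finset.sum_mul_sq_le_sq_mul_sq _ _ _).trans ?_)
  have hn4 : ∀ v, 0 ≤ 4 + n v := fun v => by linarith [hn0 v]
  simp only [Real.sq_sqrt (hgL _), Real.sq_sqrt (hn4 _)]
  have h2 : ∑ v, (4 + n v) = 4 * (N + 1) + T := by
    rw [Finset.sum_add_distrib, hn, Finset.sum_comm,
      Finset.sum_congr rfl fun t ht => (hw t (Finset.mem_range.1 ht)).2]
    simp
    ring
  have h3 : ∑ v, (g v + L) ≤ T * ε + 2 * (N + 1) * (d * Real.log (4 * d + T)) := by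
    rw [Finset.sum_add_distrib, hg, Finset.sum_comm]
    have := Finset.sum_le_sum fun t ht => hdef t (Finset.mem_range.1 ht)
    refine (add_le_add_left this _).trans (le_of_eq ?_)
    simp [hL]
    ring
  rw [h2]
  exact mul_le_mul_of_nonneg_left h3 (by positivity)

/-! ### Computation rules for stores and programs -/

@[simp] lemma Store.setNat_nat (s : Store) (v n u : ℕ) :
    (s.setNat v n).nat u = if u = v then n else s.nat u := rfl

@[simp] lemma Store.setNat_real (s : Store) (v n : ℕ) : (s.setNat v n).real = s.real := rfl

@[simp] lemma Store.setReal_nat (s : Store) (a i j k : ℕ) (r : ℝ) :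
    (s.setReal a i j k r).nat = s.nat := rfl

@[simp] lemma Store.setReal_real (s : Store) (a i j k : ℕ) (r : ℝ) (a' i' j' k' : ℕ) :
    (s.setReal a i j k r).real a' i' j' k' =
      if a' = a ∧ i' = i ∧ j' = j ∧ k' = k then r else s.real a' i' j' k' := rfl

open Classical in
lemma Program.exec_ite (b : Test) (c₁ c₂ : Program) (s : Store) :
    (Program.ite b c₁ c₂).exec s = if b.holds s then c₁.exec s else c₂.exec s := rfl

lemma Program.exec_loop (v : ℕ) (e : NatTerm) (c : Program) (s : Store) :
    (Program.loop v e c).exec s = iterate v c.exec s (e.eval s) := rfl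

lemma Program.exec_seq (c₁ c₂ : Program) (s : Store) :
    (Program.seq c₁ c₂).exec s = c₂.exec (c₁.exec s) := rfl

/-! ### Frame rules -/

/-- The program does not assign to the integer variable `u`. -/
def Program.KeepsNat (u : ℕ) : Program → Prop
  | .skip => True
  | .setNat v _ => u ≠ v
  | .setReal _ _ _ _ _ => True
  | .seq c₁ c₂ => c₁.KeepsNat u ∧ c₂.KeepsNat u
  | .ite _ c₁ c₂ => c₁.KeepsNat u ∧ c₂.KeepsNat u
  | .loop v _ c => u ≠ v ∧ c.KeepsNat u

/-- The program does not assign to the real array `a`. -/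
def Program.KeepsReal (a : ℕ) : Program → Prop
  | .skip => True
  | .setNat _ _ => True
  | .setReal b _ _ _ _ => a ≠ b
  | .seq c₁ c₂ => c₁.KeepsReal a ∧ c₂.KeepsReal a
  | .ite _ c₁ c₂ => c₁.KeepsReal a ∧ c₂.KeepsReal a
  | .loop _ _ c => c.KeepsReal a

/-- Induction over the iterations of a loop. -/
lemma iterate_induction {v : ℕ} {body : Store → Store} {s : Store} {n : ℕ}
    (I : ℕ → Store → Prop) (h0 : I 0 s)
    (hs : ∀ m < n, ∀ s', I m s' → I (m + 1) (body (s'.setNat v m))) : I n (iterate v body s n) := by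
  induction n with
  | zero => exact h0
  | succ n ih => exact hs n n.lt_succ_self _ (ih fun m hm => hs m (hm.trans n.lt_succ_self))

lemma Program.exec_nat {u : ℕ} : ∀ {c : Program}, c.KeepsNat u → ∀ s, (c.exec s).nat u = s.nat u
  | .skip, _, _ => rfl
  | .setNat _ _, h, _ => if_neg h
  | .setReal _ _ _ _ _, _, _ => rfl
  | .seq _ _, h, s => by rw [Program.exec, exec_nat h.2, exec_nat h.1]
  | .ite b _ _, h, s => by
      rw [Program.exec_ite]
      split_ifs
      exacts [exec_nat h.1 s, exec_nat h.2 s]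
  | .loop v e c, h, s => by
      rw [Program.exec_loop]
      refine iterate_induction (fun _ s' => s'.nat u = s.nat u) rfl fun m _ s' hs' => ?_
      rw [exec_nat h.2, ← hs']
      exact if_neg h.1

lemma Program.exec_real {a : ℕ} : ∀ {c : Program}, c.KeepsReal a →
    ∀ s, (c.exec s).real a = s.real a
  | .skip, _, _ => rfl
  | .setNat _ _, _, _ => rfl
  | .setReal b i j k e, h, s => by
      funext i' j' k'
      exact if_neg fun h' => h h'.1
  | .seq _ _, h, s => by rw [Program.exec, exec_real h.2, exec_real h.1]
  | .ite b _ _, h, s => by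
      rw [Program.exec_ite]
      split_ifs
      exacts [exec_real h.1 s, exec_real h.2 s]
  | .loop v e c, h, s => by
      rw [Program.exec_loop]
      refine iterate_induction (fun _ s' => s'.real a = s.real a) rfl fun m _ s' hs' => ?_
      rw [exec_real (c := c) h, ← hs']
      rfl

/-! ### Running time -/

/-- All loops of the program are bounded by variables in `V`, up to an additive constant, and the
program does not assign to these variables. -/
def Program.LoopsBoundedBy (V : Finset ℕ) : Program → Prop
  | .skip => True
  | .setNat v _ => v ∉ V
  | .setReal _ _ _ _ _ => True
  | .seq c₁ c₂ => c₁.LoopsBoundedBy V ∧ c₂.LoopsBoundedBy V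
  | .ite _ c₁ c₂ => c₁.LoopsBoundedBy V ∧ c₂.LoopsBoundedBy V
  | .loop v e c => v ∉ V ∧ (∃ u ∈ V, e = .var u ∨ e = .plus (.var u) (.const 1)) ∧
      c.LoopsBoundedBy V

lemma Program.LoopsBoundedBy.keepsNat {V : Finset ℕ} {u : ℕ} (hu : u ∈ V) :
    ∀ {c : Program}, c.LoopsBoundedBy V → c.KeepsNat u
  | .skip, _ => trivial
  | .setNat _ _, h => fun e => h (e ▸ hu)
  | .setReal _ _ _ _ _, _ => trivial
  | .seq _ _, h => ⟨h.1.keepsNat hu, h.2.keepsNat hu⟩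
  | .ite _ _ _, h => ⟨h.1.keepsNat hu, h.2.keepsNat hu⟩
  | .loop _ _ _, h => ⟨fun e => h.1 (e ▸ hu), h.2.2.keepsNat hu⟩

lemma const_le_pow (K n : ℕ) : n ≤ (K + 2) ^ n :=
  (Nat.lt_pow_self (by omega)).le

/-- Since K + 2 is at least 2, bounds by powers of K + 2 are closed under addition, with an exponent
independent of K. Every time bound can therefore be kept as a single power. -/
lemma pow_add_pow_le (K a b : ℕ) : (K + 2) ^ a + (K + 2) ^ b ≤ (K + 2) ^ (a + b + 1) := by
  have h1 : (K + 2) ^ a ≤ (K + 2) ^ (a + b) := Nat.pow_le_pow_right (by omega) (by omega)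
  have h2 : (K + 2) ^ b ≤ (K + 2) ^ (a + b) := Nat.pow_le_pow_right (by omega) (by omega)
  rw [pow_succ]
  nlinarith [Nat.zero_le ((K + 2) ^ (a + b) * K)]

/-- A program whose loops are bounded by protected variables takes polynomial time. -/
theorem Program.exists_time_le {V : Finset ℕ} : ∀ {c : Program}, c.LoopsBoundedBy V →
    ∃ a : ℕ, ∀ (K : ℕ) (s : Store), (∀ u ∈ V, s.nat u ≤ K) → c.time s ≤ (K + 2) ^ a
  | .skip, _ => ⟨0, fun _ _ _ => le_rfl⟩
  | .setNat _ e, _ => ⟨e.cost + 1, fun K _ _ => const_le_pow K _⟩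
  | .setReal _ i j k e, _ =>
      ⟨i.cost + j.cost + k.cost + e.cost + 1, fun K _ _ => const_le_pow K _⟩
  | .seq c₁ c₂, h => by
      obtain ⟨a, ha⟩ := exists_time_le h.1
      obtain ⟨b, hb⟩ := exists_time_le h.2
      refine ⟨a + b + 1, fun K s hs => ?_⟩
      refine (add_le_add (ha K s hs) (hb K _ fun u hu => ?_)).trans (pow_add_pow_le K a b)
      rw [Program.exec_nat (h.1.keepsNat hu)]
      exact hs u hu
  | .ite t c₁ c₂, h => by
      obtain ⟨a, ha⟩ := exists_time_le h.1
      obtain ⟨b, hb⟩ := exists_time_le h.2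
      refine ⟨t.cost + (a + b + 1) + 1, fun K s hs => ?_⟩
      rw [Program.time]
      refine (add_le_add (const_le_pow K _) ?_).trans (pow_add_pow_le K _ _)
      refine le_trans ?_ (pow_add_pow_le K a b)
      split_ifs
      · exact (ha K s hs).trans (Nat.le_add_right _ _)
      · exact (hb K s hs).trans (Nat.le_add_left _ _)
  | .loop v e c, h => by
      obtain ⟨a, ha⟩ := exists_time_le h.2.2
      refine ⟨(e.cost + 1) + (a + 2) + 1, fun K s hs => ?_⟩
      rw [Program.time]
      refine (add_le_add (const_le_pow K _) ?_).trans (pow_add_pow_le K _ _)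
      have he : e.eval s ≤ K + 2 := by
        obtain ⟨u, hu, rfl | rfl⟩ := h.2.1 <;> have := hs u hu <;>
          simp only [NatTerm.eval] <;> omega
      have hit : ∀ i u, u ∈ V → (iterate v c.exec s i).nat u = s.nat u := by
        intro i u hu
        refine iterate_induction (fun _ s' => s'.nat u = s.nat u) rfl fun m _ s' hs' => ?_
        rw [Program.exec_nat (h.2.2.keepsNat hu), ← hs']
        exact if_neg fun h' => h.1 (by rwa [← h'])
      calc _ ≤ ∑ i ∈ Finset.range (e.eval s), 2 * (K + 2) ^ a := by
            refine Finset.sum_le_sum fun i _ => ?_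
            have h1 : 1 ≤ (K + 2) ^ a := Nat.one_le_pow _ _ (by omega)
            have h2 := ha K ((iterate v c.exec s i).setNat v i) fun u hu => by
              rw [Store.setNat_nat, if_neg fun h' => h.1 (by rwa [← h']), hit i u hu]
              exact hs u hu
            omega
        _ = e.eval s * (2 * (K + 2) ^ a) := by
            rw [Finset.sum_const, Finset.card_range, smul_eq_mul]
        _ ≤ (K + 2) * ((K + 2) * (K + 2) ^ a) :=
            Nat.mul_le_mul he (Nat.mul_le_mul_right _ (by omega))
        _ = (K + 2) ^ (a + 2) := by ring

/-! ### Programs that update one array -/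

/-- The stores agree on the variables in `V` and on all arrays other than `a`. -/
def Agree (V : List ℕ) (a : ℕ) (s s₀ : Store) : Prop :=
  (∀ u ∈ V, s.nat u = s₀.nat u) ∧ ∀ b ≠ a, s.real b = s₀.real b

lemma Agree.refl (V : List ℕ) (a : ℕ) (s : Store) : Agree V a s s :=
  ⟨fun _ _ => rfl, fun _ _ => rfl⟩

/-- The program writes only to the array `a` and to variables outside of `V`. -/
def Program.Local (V : List ℕ) (a : ℕ) (c : Program) : Prop :=
  (∀ u ∈ V, c.KeepsNat u) ∧ ∀ b ≠ a, c.KeepsReal b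

lemma Program.Local.agree {V : List ℕ} {a : ℕ} {c : Program} (hc : c.Local V a) {s s₀ : Store}
    (h : Agree V a s s₀) : Agree V a (c.exec s) s₀ :=
  ⟨fun u hu => (exec_nat (hc.1 u hu) s).trans (h.1 u hu),
    fun b hb => (exec_real (hc.2 b hb) s).trans (h.2 b hb)⟩

/-- On stores that agree with `s₀`, the program applies `U` to the cells of the array `a` in the
region `R`, and does not touch the other cells of `a`. -/
def Updates (V : List ℕ) (a : ℕ) (c : Program) (s₀ : Store) (R : ℕ → ℕ → ℕ → Prop)
    (U : ℕ → ℕ → ℕ → ℝ → ℝ) : Prop :=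
  ∀ s, Agree V a s s₀ → ∀ i j k,
    (R i j k → (c.exec s).real a i j k = U i j k (s.real a i j k)) ∧
    (¬ R i j k → (c.exec s).real a i j k = s.real a i j k)

lemma updates_setReal {V : List ℕ} {a : ℕ} {i j k : NatTerm} {e : RealTerm} {s₀ : Store}
    {R : ℕ → ℕ → ℕ → Prop} {U : ℕ → ℕ → ℕ → ℝ → ℝ}
    (hR : ∀ s, Agree V a s s₀ → ∀ i' j' k',
      R i' j' k' ↔ i' = i.eval s ∧ j' = j.eval s ∧ k' = k.eval s)
    (hU : ∀ s, Agree V a s s₀ → e.eval s =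
      U (i.eval s) (j.eval s) (k.eval s) (s.real a (i.eval s) (j.eval s) (k.eval s))) :
    Updates V a (.setReal a i j k e) s₀ R U := by
  intro s hs i' j' k'
  rw [Program.exec, Store.setReal_real]
  have := hR s hs i' j' k'
  refine ⟨fun h => ?_, fun h => if_neg fun h' => h (this.2 h'.2)⟩
  obtain ⟨rfl, rfl, rfl⟩ := this.1 h
  rw [if_pos ⟨rfl, rfl, rfl, rfl⟩, hU s hs]

/-- Locality of the first program preserves agreement with `s₀`, so the second specification still
applies; `U₁` and `U₂` may read other arrays through `s₀`, which neither program changes. -/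
lemma Updates.seq {V : List ℕ} {a : ℕ} {c₁ c₂ : Program} {s₀ : Store}
    {R : ℕ → ℕ → ℕ → Prop} {U₁ U₂ : ℕ → ℕ → ℕ → ℝ → ℝ} (hl : c₁.Local V a)
    (h₁ : Updates V a c₁ s₀ R U₁) (h₂ : Updates V a c₂ s₀ R U₂) :
    Updates V a (.seq c₁ c₂) s₀ R fun i j k r => U₂ i j k (U₁ i j k r) := by
  intro s hs i j k
  have e₁ := h₁ s hs i j k
  have e₂ := h₂ _ (hl.agree hs) i j k
  rw [Program.exec_seq]
  exact ⟨fun h => by rw [e₂.1 h, e₁.1 h], fun h => by rw [e₂.2 h, e₁.2 h]⟩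

/-- Inside a loop body the loop variable has a known value and may be read, hence the list v :: V;
between iterations only agreement on V is retained. -/
lemma agree_setNat {V : List ℕ} {a v n : ℕ} {s s₀ : Store} (hv : v ∉ V) (h : Agree V a s s₀) :
    Agree (v :: V) a (s.setNat v n) (s₀.setNat v n) ∧ Agree V a (s.setNat v n) s₀ := by
  refine ⟨⟨fun u hu => ?_, h.2⟩, fun u hu => ?_, h.2⟩
  · rw [Store.setNat_nat, Store.setNat_nat]
    split_ifs with h'
    · rfl
    · exact h.1 u ((List.mem_cons.1 hu).resolve_left h')
  · rw [Store.setNat_nat, if_neg fun h' => hv (by rwa [← h'])]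
    exact h.1 u hu

/-- A loop that visits disjoint regions. -/
lemma Updates.loop {V : List ℕ} {a v B : ℕ} {e : NatTerm} {c : Program} {s₀ : Store}
    {R : ℕ → ℕ → ℕ → ℕ → Prop} {U : ℕ → ℕ → ℕ → ℝ → ℝ} (hv : v ∉ V) (hl : c.Local V a)
    (he : ∀ s, Agree V a s s₀ → e.eval s = B)
    (hdisj : ∀ m n i j k, R m i j k → R n i j k → m = n)
    (h : ∀ n < B, Updates (v :: V) a c (s₀.setNat v n) (R n) U) :
    Updates V a (.loop v e c) s₀ (fun i j k => ∃ n < B, R n i j k) U := by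
  intro s hs
  rw [Program.exec_loop, he s hs]
  refine (iterate_induction (n := B) (I := fun n s' => Agree V a s' s₀ ∧ ∀ i j k,
    ((∃ m < n, R m i j k) → s'.real a i j k = U i j k (s.real a i j k)) ∧
    ((¬ ∃ m < n, R m i j k) → s'.real a i j k = s.real a i j k))
    ⟨hs, fun i j k => by simp⟩ fun n hn s' hs' => ?_).2
  obtain ⟨h1, h2⟩ := agree_setNat (n := n) hv hs'.1
  refine ⟨hl.agree h2, fun i j k => ?_⟩
  have e₁ := hs'.2 i j k
  have e₂ := h n hn _ h1 i j k
  rw [Store.setNat_real] at e₂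
  constructor
  · rintro ⟨m, hm, hR⟩
    by_cases hmn : m = n
    · subst hmn
      rw [e₂.1 hR, e₁.2 fun ⟨m', hm', hR'⟩ => hm'.ne (hdisj _ _ _ _ _ hR' hR)]
    · rw [e₂.2 fun hR' => hmn (hdisj _ _ _ _ _ hR hR'), e₁.1 ⟨m, by omega, hR⟩]
  · intro hR
    rw [e₂.2 fun hR' => hR ⟨n, n.lt_succ_self, hR'⟩,
      e₁.2 fun ⟨m, hm, hR'⟩ => hR ⟨m, hm.trans n.lt_succ_self, hR'⟩]

/-- A loop that accumulates a sum. -/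
lemma Updates.loop_sum {V : List ℕ} {a v B : ℕ} {e : NatTerm} {c : Program} {s₀ : Store}
    {R : ℕ → ℕ → ℕ → Prop} {f : ℕ → ℕ → ℕ → ℕ → ℝ} (hv : v ∉ V) (hl : c.Local V a)
    (he : ∀ s, Agree V a s s₀ → e.eval s = B)
    (h : ∀ n < B, Updates (v :: V) a c (s₀.setNat v n) R fun i j k r => r + f n i j k) :
    Updates V a (.loop v e c) s₀ R fun i j k r => r + ∑ n ∈ Finset.range B, f n i j k := by
  intro s hs
  rw [Program.exec_loop, he s hs]
  refine (iterate_induction (n := B) (I := fun n s' => Agree V a s' s₀ ∧ ∀ i j k,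
    (R i j k → s'.real a i j k = s.real a i j k + ∑ m ∈ Finset.range n, f m i j k) ∧
    (¬ R i j k → s'.real a i j k = s.real a i j k))
    ⟨hs, fun i j k => by simp⟩ fun n hn s' hs' => ?_).2
  obtain ⟨h1, h2⟩ := agree_setNat (n := n) hv hs'.1
  refine ⟨hl.agree h2, fun i j k => ?_⟩
  have e₁ := hs'.2 i j k
  have e₂ := h n hn _ h1 i j k
  rw [Store.setNat_real] at e₂
  refine ⟨fun hR => ?_, fun hR => by rw [e₂.2 hR, e₁.2 hR]⟩
  rw [e₂.1 hR, e₁.1 hR, Finset.sum_range_succ, ← add_assoc]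

namespace Forecaster

/-! The integer variables `3`, `4`, `5` are loop variables. For each bucket `v`, the array `3` holds
the inverse of the Gram matrix, and `4` the residual sum; `5` holds the product of the inverse with
the current context, `6` the ridge prediction, and `7` the leverage of the context. -/

/-- Run over the buckets `0, …, N`. -/
def bucketLoop (c : Program) : Program := .loop 3 (.plus (.var 2) (.const 1)) c

def applyInverse : Program :=
  bucketLoop <| .loop 4 (.var 1) <| .seq
    (.setReal 5 (.var 3) (.var 4) (.const 0) (.const 0))
    (.loop 5 (.var 1) <| .setReal 5 (.var 3) (.var 4) (.const 0) <|
      .plus (.cell 5 (.var 3) (.var 4) (.const 0))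
        (.times (.cell 3 (.var 3) (.var 4) (.var 5)) (.cell 0 (.var 5) (.const 0) (.const 0))))

def computePrediction : Program :=
  bucketLoop <| .seq
    (.setReal 6 (.var 3) (.const 0) (.const 0) (.const 0))
    (.loop 4 (.var 1) <| .setReal 6 (.var 3) (.const 0) (.const 0) <|
      .plus (.cell 6 (.var 3) (.const 0) (.const 0))
        (.times (.cell 5 (.var 3) (.var 4) (.const 0)) (.cell 4 (.var 3) (.var 4) (.const 0))))

def computeLeverage : Program :=
  bucketLoop <| .seq
    (.setReal 7 (.var 3) (.const 0) (.const 0) (.const 0))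
    (.loop 4 (.var 1) <| .setReal 7 (.var 3) (.const 0) (.const 0) <|
      .plus (.cell 7 (.var 3) (.const 0) (.const 0))
        (.times (.cell 0 (.var 4) (.const 0) (.const 0)) (.cell 5 (.var 3) (.var 4) (.const 0))))

/-- Leaves in the variable `8` the position of a sign change of the ridge predictions. -/
def findSignChange : Program :=
  .seq (.setNat 8 (.const 0)) <| bucketLoop <|
    .ite (.realLE (.cell 6 (.var 3) (.const 0) (.const 0)) (.const 0)) .skip
      (.setNat 8 (.plus (.var 3) (.const 1)))

/-- The forecast writes at most two cells, so the weights of the previous round have to be erased.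
-/
def clearWeights : Program :=
  bucketLoop <| .setReal 2 (.var 3) (.const 0) (.const 0) (.const 0)

/-- The ridge prediction just before the sign change. -/
def leftTerm : RealTerm := .cell 6 (.minus (.var 8) (.const 1)) (.const 0) (.const 0)

/-- The ridge prediction at the sign change. -/
def rightTerm : RealTerm := .cell 6 (.var 8) (.const 0) (.const 0)

def fillWeights : Program :=
  .ite (.natLE (.var 8) (.const 0)) (.setReal 2 (.const 0) (.const 0) (.const 0) (.const 1)) <|
    .ite (.natLE (.var 8) (.var 2))
      (.seq
        (.setReal 2 (.minus (.var 8) (.const 1)) (.const 0) (.const 0)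
          (.quot (.minus (.const 0) rightTerm) (.minus leftTerm rightTerm)))
        (.setReal 2 (.var 8) (.const 0) (.const 0) (.quot leftTerm (.minus leftTerm rightTerm))))
      (.setReal 2 (.var 2) (.const 0) (.const 0) (.const 1))

def predict : Program :=
  .seq applyInverse <| .seq computePrediction <| .seq computeLeverage <|
    .seq findSignChange <| .seq clearWeights fillWeights

def weightTerm : RealTerm := .cell 2 (.var 3) (.const 0) (.const 0)

/-- A Sherman–Morrison step in each bucket, reading the products and leverages left by `predict`; no
matrix is ever inverted. -/
def updateInverse : Program :=
  bucketLoop <| .loop 4 (.var 1) <| .loop 5 (.var 1) <|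
    .setReal 3 (.var 3) (.var 4) (.var 5) <|
      .minus (.cell 3 (.var 3) (.var 4) (.var 5))
        (.times
          (.quot weightTerm
            (.plus (.const 1) (.times weightTerm (.cell 7 (.var 3) (.const 0) (.const 0)))))
          (.times (.cell 5 (.var 3) (.var 4) (.const 0)) (.cell 5 (.var 3) (.var 5) (.const 0))))

def updateResidual : Program :=
  bucketLoop <| .loop 4 (.var 1) <|
    .setReal 4 (.var 3) (.var 4) (.const 0) <|
      .plus (.cell 4 (.var 3) (.var 4) (.const 0))
        (.times
          (.times weightTerm
            (.minus (.cell 1 (.const 0) (.const 0) (.const 0))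
              (.quot (.ofNat (.var 3)) (.ofNat (.var 2)))))
          (.cell 0 (.var 4) (.const 0) (.const 0)))

def update : Program := .seq updateInverse updateResidual

/-- Leaves in the variable `7` an integer logarithm of the horizon. -/
def computeLog : Program :=
  .seq (.setNat 6 (.const 1)) <| .loop 3 (.var 0) <|
    .ite (.natLE (.var 6) (.var 0))
      (.seq (.setNat 6 (.plus (.var 6) (.var 6))) (.setNat 7 (.plus (.var 7) (.const 1)))) .skip

/-- A search over the integers below T replaces the cube root of T/(d log T): the test multiplies
out and compares. The value kept is one more than an accepted integer. -/
def computeGridSize : Program :=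
  .loop 3 (.var 0) <|
    .ite (.realLE
        (.times (.times (.ofNat (.var 3)) (.times (.ofNat (.var 3)) (.ofNat (.var 3))))
          (.times (.ofNat (.var 1)) (.ofNat (.var 7))))
        (.ofNat (.var 0)))
      (.setNat 2 (.plus (.var 3) (.const 1))) .skip

/-- The inverse of 4 I; the memory starts at zero, so only the diagonal is written. -/
def initInverse : Program :=
  bucketLoop <| .loop 4 (.var 1) <| .setReal 3 (.var 3) (.var 4) (.var 4) (.const (1 / 4))

def init : Program := .seq (.seq computeLog computeGridSize) initInverse

def algorithm : OnlineAlgorithm := ⟨init, predict, update⟩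

/-! ### Effect of the programs -/

lemma bucketLoop_bound {V : List ℕ} {a : ℕ} {s s₀ : Store} (hV : 2 ∈ V) (hs : Agree V a s s₀) :
    (NatTerm.plus (.var 2) (.const 1)).eval s = s₀.nat 2 + 1 := by
  simp [NatTerm.eval, hs.1 2 hV]

lemma applyInverse_real (s₀ : Store) {v i : ℕ} (hv : v ≤ s₀.nat 2) (hi : i < s₀.nat 1) :
    (applyInverse.exec s₀).real 5 v i 0 =
      ∑ j ∈ Finset.range (s₀.nat 1), s₀.real 3 v i j * s₀.real 0 j 0 0 := by
  have h : Updates [2, 1] 5 applyInverse s₀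
      (fun i' j' k' => ∃ v < s₀.nat 2 + 1, ∃ i < s₀.nat 1, i' = v ∧ j' = i ∧ k' = 0)
      (fun v i _ _ => 0 +
        ∑ j ∈ Finset.range (s₀.nat 1), s₀.real 3 v i j * s₀.real 0 j 0 0) := by
    refine Updates.loop (by simp) (by simp [Program.Local, Program.KeepsNat, Program.KeepsReal])
      (fun s hs => bucketLoop_bound (by simp) hs) (by grind) fun v _ => ?_
    refine Updates.loop (by simp) (by simp [Program.Local, Program.KeepsNat, Program.KeepsReal])
      (fun s hs => by simpa [NatTerm.eval] using hs.1 1 (by simp)) (by grind) fun i _ => ?_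
    refine Updates.seq (U₁ := fun _ _ _ _ => 0)
      (U₂ := fun v i _ r => r + ∑ j ∈ Finset.range (s₀.nat 1), s₀.real 3 v i j * s₀.real 0 j 0 0)
      (by simp [Program.Local, Program.KeepsNat, Program.KeepsReal]) ?_ ?_
    · refine updates_setReal (fun s hs i' j' k' => ?_) fun s hs => by simp [RealTerm.eval]
      have e3 := hs.1 3 (by simp)
      have e4 := hs.1 4 (by simp)
      simp at e3 e4
      simp [NatTerm.eval, e3, e4]
    · refine Updates.loop_sum (f := fun j v i _ => s₀.real 3 v i j * s₀.real 0 j 0 0) (by simp)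
        (by simp [Program.Local, Program.KeepsNat, Program.KeepsReal])
        (fun s hs => by simpa [NatTerm.eval] using hs.1 1 (by simp)) fun j _ => ?_
      refine updates_setReal (fun s hs i' j' k' => ?_) fun s hs => ?_
      all_goals
        have e3 := hs.1 3 (by simp)
        have e4 := hs.1 4 (by simp)
        have e5 := hs.1 5 (by simp)
        simp at e3 e4 e5
        simp [NatTerm.eval, RealTerm.eval, e3, e4, e5, hs.2 3, hs.2 0]
  have := (h s₀ (Agree.refl _ _ _) v i 0).1 ⟨v, by omega, i, hi, rfl, rfl, rfl⟩
  simpa using this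

lemma computePrediction_real (s₀ : Store) {v : ℕ} (hv : v ≤ s₀.nat 2) :
    (computePrediction.exec s₀).real 6 v 0 0 =
      ∑ i ∈ Finset.range (s₀.nat 1), s₀.real 5 v i 0 * s₀.real 4 v i 0 := by
  have h : Updates [2, 1] 6 computePrediction s₀
      (fun i' j' k' => ∃ v < s₀.nat 2 + 1, i' = v ∧ j' = 0 ∧ k' = 0)
      (fun v _ _ _ => 0 +
        ∑ i ∈ Finset.range (s₀.nat 1), s₀.real 5 v i 0 * s₀.real 4 v i 0) := by
    refine Updates.loop (by simp) (by simp [Program.Local, Program.KeepsNat, Program.KeepsReal])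
      (fun s hs => bucketLoop_bound (by simp) hs) (by grind) fun v _ => ?_
    refine Updates.seq (U₁ := fun _ _ _ _ => 0)
      (U₂ := fun v _ _ r => r + ∑ i ∈ Finset.range (s₀.nat 1), s₀.real 5 v i 0 * s₀.real 4 v i 0)
      (by simp [Program.Local, Program.KeepsNat, Program.KeepsReal]) ?_ ?_
    · refine updates_setReal (fun s hs i' j' k' => ?_) fun s hs => by simp [RealTerm.eval]
      have e3 := hs.1 3 (by simp)
      simp at e3
      simp [NatTerm.eval, e3]
    · refine Updates.loop_sum (f := fun i v _ _ => s₀.real 5 v i 0 * s₀.real 4 v i 0) (by simp)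
        (by simp [Program.Local, Program.KeepsNat, Program.KeepsReal])
        (fun s hs => by simpa [NatTerm.eval] using hs.1 1 (by simp)) fun i _ => ?_
      refine updates_setReal (fun s hs i' j' k' => ?_) fun s hs => ?_
      all_goals
        have e3 := hs.1 3 (by simp)
        have e4 := hs.1 4 (by simp)
        simp at e3 e4
        simp [NatTerm.eval, RealTerm.eval, e3, e4, hs.2 4, hs.2 5]
  have := (h s₀ (Agree.refl _ _ _) v 0 0).1 ⟨v, by omega, rfl, rfl, rfl⟩
  simpa using this

lemma computeLeverage_real (s₀ : Store) {v : ℕ} (hv : v ≤ s₀.nat 2) :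
    (computeLeverage.exec s₀).real 7 v 0 0 =
      ∑ i ∈ Finset.range (s₀.nat 1), s₀.real 0 i 0 0 * s₀.real 5 v i 0 := by
  have h : Updates [2, 1] 7 computeLeverage s₀
      (fun i' j' k' => ∃ v < s₀.nat 2 + 1, i' = v ∧ j' = 0 ∧ k' = 0)
      (fun v _ _ _ => 0 +
        ∑ i ∈ Finset.range (s₀.nat 1), s₀.real 0 i 0 0 * s₀.real 5 v i 0) := by
    refine Updates.loop (by simp) (by simp [Program.Local, Program.KeepsNat, Program.KeepsReal])
      (fun s hs => bucketLoop_bound (by simp) hs) (by grind) fun v _ => ?_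
    refine Updates.seq (U₁ := fun _ _ _ _ => 0)
      (U₂ := fun v _ _ r => r + ∑ i ∈ Finset.range (s₀.nat 1), s₀.real 0 i 0 0 * s₀.real 5 v i 0)
      (by simp [Program.Local, Program.KeepsNat, Program.KeepsReal]) ?_ ?_
    · refine updates_setReal (fun s hs i' j' k' => ?_) fun s hs => by simp [RealTerm.eval]
      have e3 := hs.1 3 (by simp)
      simp at e3
      simp [NatTerm.eval, e3]
    · refine Updates.loop_sum (f := fun i v _ _ => s₀.real 0 i 0 0 * s₀.real 5 v i 0) (by simp)
        (by simp [Program.Local, Program.KeepsNat, Program.KeepsReal])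
        (fun s hs => by simpa [NatTerm.eval] using hs.1 1 (by simp)) fun i _ => ?_
      refine updates_setReal (fun s hs i' j' k' => ?_) fun s hs => ?_
      all_goals
        have e3 := hs.1 3 (by simp)
        have e4 := hs.1 4 (by simp)
        simp at e3 e4
        simp [NatTerm.eval, RealTerm.eval, e3, e4, hs.2 0, hs.2 5]
  have := (h s₀ (Agree.refl _ _ _) v 0 0).1 ⟨v, by omega, rfl, rfl, rfl⟩
  simpa using this

lemma clearWeights_real (s₀ : Store) {v : ℕ} (hv : v ≤ s₀.nat 2) :
    (clearWeights.exec s₀).real 2 v 0 0 = 0 := by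
  have h : Updates [2] 2 clearWeights s₀
      (fun i' j' k' => ∃ v < s₀.nat 2 + 1, i' = v ∧ j' = 0 ∧ k' = 0) (fun _ _ _ _ => 0) := by
    refine Updates.loop (by simp) (by simp [Program.Local, Program.KeepsNat, Program.KeepsReal])
      (fun s hs => bucketLoop_bound (by simp) hs) (by grind) fun v _ => ?_
    refine updates_setReal (fun s hs i' j' k' => ?_) fun s hs => by simp [RealTerm.eval]
    have e3 := hs.1 3 (by simp)
    simp at e3
    simp [NatTerm.eval, e3]
  exact (h s₀ (Agree.refl _ _ _) v 0 0).1 ⟨v, by omega, rfl, rfl, rfl⟩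

lemma updateInverse_real (s₀ : Store) {v i j : ℕ} (hv : v ≤ s₀.nat 2) (hi : i < s₀.nat 1)
    (hj : j < s₀.nat 1) :
    (updateInverse.exec s₀).real 3 v i j = s₀.real 3 v i j -
      s₀.real 2 v 0 0 / (1 + s₀.real 2 v 0 0 * s₀.real 7 v 0 0) *
        (s₀.real 5 v i 0 * s₀.real 5 v j 0) := by
  have h : Updates [2, 1] 3 updateInverse s₀
      (fun i' j' k' => ∃ v < s₀.nat 2 + 1, ∃ i < s₀.nat 1, ∃ j < s₀.nat 1,
        i' = v ∧ j' = i ∧ k' = j)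
      (fun v i j r => r - s₀.real 2 v 0 0 / (1 + s₀.real 2 v 0 0 * s₀.real 7 v 0 0) *
        (s₀.real 5 v i 0 * s₀.real 5 v j 0)) := by
    refine Updates.loop (by simp) (by simp [Program.Local, Program.KeepsNat, Program.KeepsReal])
      (fun s hs => bucketLoop_bound (by simp) hs) (by grind) fun v _ => ?_
    refine Updates.loop (by simp) (by simp [Program.Local, Program.KeepsNat, Program.KeepsReal])
      (fun s hs => by simpa [NatTerm.eval] using hs.1 1 (by simp)) (by grind) fun i _ => ?_
    refine Updates.loop (by simp) (by simp [Program.Local, Program.KeepsNat, Program.KeepsReal])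
      (fun s hs => by simpa [NatTerm.eval] using hs.1 1 (by simp)) (by grind) fun j _ => ?_
    refine updates_setReal (fun s hs i' j' k' => ?_) fun s hs => ?_
    all_goals
      have e3 := hs.1 3 (by simp)
      have e4 := hs.1 4 (by simp)
      have e5 := hs.1 5 (by simp)
      simp at e3 e4 e5
      simp [NatTerm.eval, RealTerm.eval, weightTerm, e3, e4, e5, hs.2 2, hs.2 5, hs.2 7]
  exact (h s₀ (Agree.refl _ _ _) v i j).1 ⟨v, by omega, i, hi, j, hj, rfl, rfl, rfl⟩

lemma updateResidual_real (s₀ : Store) {v i : ℕ} (hv : v ≤ s₀.nat 2) (hi : i < s₀.nat 1) :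
    (updateResidual.exec s₀).real 4 v i 0 = s₀.real 4 v i 0 +
      s₀.real 2 v 0 0 * (s₀.real 1 0 0 0 - (v : ℝ) / s₀.nat 2) * s₀.real 0 i 0 0 := by
  have h : Updates [2, 1] 4 updateResidual s₀
      (fun i' j' k' => ∃ v < s₀.nat 2 + 1, ∃ i < s₀.nat 1, i' = v ∧ j' = i ∧ k' = 0)
      (fun v i _ r => r +
        s₀.real 2 v 0 0 * (s₀.real 1 0 0 0 - (v : ℝ) / s₀.nat 2) * s₀.real 0 i 0 0) := by
    refine Updates.loop (by simp) (by simp [Program.Local, Program.KeepsNat, Program.KeepsReal])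
      (fun s hs => bucketLoop_bound (by simp) hs) (by grind) fun v _ => ?_
    refine Updates.loop (by simp) (by simp [Program.Local, Program.KeepsNat, Program.KeepsReal])
      (fun s hs => by simpa [NatTerm.eval] using hs.1 1 (by simp)) (by grind) fun i _ => ?_
    refine updates_setReal (fun s hs i' j' k' => ?_) fun s hs => ?_
    all_goals
      have e2 := hs.1 2 (by simp)
      have e3 := hs.1 3 (by simp)
      have e4 := hs.1 4 (by simp)
      simp at e2 e3 e4
      simp [NatTerm.eval, RealTerm.eval, weightTerm, e2, e3, e4, hs.2 0, hs.2 1, hs.2 2]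
  exact (h s₀ (Agree.refl _ _ _) v i 0).1 ⟨v, by omega, i, hi, rfl, rfl, rfl⟩

lemma initInverse_real (s₀ : Store) (h0 : ∀ v i j, s₀.real 3 v i j = 0) {v i j : ℕ}
    (hv : v ≤ s₀.nat 2) (hi : i < s₀.nat 1) :
    (initInverse.exec s₀).real 3 v i j = if i = j then 1 / 4 else 0 := by
  have h : Updates [2, 1] 3 initInverse s₀
      (fun i' j' k' => ∃ v < s₀.nat 2 + 1, ∃ i < s₀.nat 1, i' = v ∧ j' = i ∧ k' = i)
      (fun _ _ _ _ => 1 / 4) := by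
    refine Updates.loop (by simp) (by simp [Program.Local, Program.KeepsNat, Program.KeepsReal])
      (fun s hs => bucketLoop_bound (by simp) hs) (by grind) fun v _ => ?_
    refine Updates.loop (by simp) (by simp [Program.Local, Program.KeepsNat, Program.KeepsReal])
      (fun s hs => by simpa [NatTerm.eval] using hs.1 1 (by simp)) (by grind) fun i _ => ?_
    refine updates_setReal (fun s hs i' j' k' => ?_) fun s hs => by simp [RealTerm.eval]
    have e3 := hs.1 3 (by simp)
    have e4 := hs.1 4 (by simp)
    simp at e3 e4
    simp [NatTerm.eval, e3, e4]
  have h1 := h s₀ (Agree.refl _ _ _) v i j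
  split_ifs with hij
  · exact h1.1 ⟨v, by omega, i, hi, rfl, rfl, hij.symm⟩
  · rw [h1.2, h0]
    rintro ⟨_, _, _, _, _, rfl, rfl⟩
    exact hij rfl

/-- Throughout the scan the variable 8 is one more than the last index with a positive prediction,
or 0 if there is none. Every later prediction seen so far is nonpositive, whatever the other sign
changes. -/
lemma findSignChange_nat (s₀ : Store) :
    IsSignChange (s₀.nat 2) (fun v => s₀.real 6 v 0 0) ((findSignChange.exec s₀).nat 8) := by
  rw [findSignChange, Program.exec_seq, bucketLoop, Program.exec_loop,
    bucketLoop_bound (V := [2]) (a := 0) (s₀ := s₀) (s := (Program.setNat 8 (.const 0)).exec s₀)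
      (by simp) ⟨by simp [Program.exec], fun _ _ => rfl⟩]
  obtain ⟨-, h1, h2, h3⟩ := iterate_induction (v := 3) (n := s₀.nat 2 + 1)
    (s := (Program.setNat 8 (.const 0)).exec s₀)
    (body := (Program.ite (.realLE (.cell 6 (.var 3) (.const 0) (.const 0)) (.const 0)) .skip
      (.setNat 8 (.plus (.var 3) (.const 1)))).exec)
    (I := fun n s => s.real = s₀.real ∧ s.nat 8 ≤ n ∧
      (0 < s.nat 8 → 0 < s₀.real 6 (s.nat 8 - 1) 0 0) ∧
      ∀ i, s.nat 8 ≤ i → i < n → s₀.real 6 i 0 0 ≤ 0)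
    (by simp [Program.exec, NatTerm.eval]) (by
      rintro m - s ⟨e, h1, h2, h3⟩
      rw [Program.exec_ite]
      split_ifs with ht
      · simp [Test.holds, RealTerm.eval, NatTerm.eval, e] at ht
        refine ⟨by simp [Program.exec, e], ?_, ?_, ?_⟩
        · simp [Program.exec]; omega
        · simpa [Program.exec] using h2
        · simp only [Program.exec, Store.setNat_nat]
          intro i hi hi'
          rcases Nat.lt_succ_iff_lt_or_eq.1 hi' with h | rfl
          · exact h3 i (by simpa using hi) h
          · exact ht
      · simp [Test.holds, RealTerm.eval, NatTerm.eval, e] at ht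
        refine ⟨by simp [Program.exec, e], ?_, ?_, ?_⟩
        · simp [Program.exec, NatTerm.eval]
        · simpa [Program.exec, NatTerm.eval] using ht
        · simp only [Program.exec, Store.setNat_nat, NatTerm.eval, if_true]
          intro i hi hi'
          omega)
  exact ⟨h1, h2, fun i hi hi' => h3 i hi (by omega)⟩

lemma fillWeights_real (s₀ : Store) (h0 : ∀ v ≤ s₀.nat 2, s₀.real 2 v 0 0 = 0) {v : ℕ}
    (hv : v ≤ s₀.nat 2) :
    (fillWeights.exec s₀).real 2 v 0 0 =
      defensiveWeights (s₀.nat 2) (fun v => s₀.real 6 v 0 0) (s₀.nat 8) v := by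
  rw [fillWeights, Program.exec_ite, Program.exec_ite, defensiveWeights]
  by_cases h8 : s₀.nat 8 = 0
  · rw [if_pos (show (Test.natLE (.var 8) (.const 0)).holds s₀ from h8.le)]
    simp [h8, Program.exec, NatTerm.eval, RealTerm.eval, h0 v hv]
  · rw [if_neg (show ¬ (Test.natLE (.var 8) (.const 0)).holds s₀ from fun h => h8 (Nat.le_zero.1 h)),
      if_neg h8]
    by_cases h8' : s₀.nat 8 ≤ s₀.nat 2
    · rw [if_pos (show (Test.natLE (.var 8) (.var 2)).holds s₀ from h8'), if_neg (by omega)]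
      simp only [Program.exec, NatTerm.eval, RealTerm.eval, leftTerm, rightTerm,
        Store.setReal_real, Store.setReal_nat]
      have h1 : s₀.nat 8 ≠ s₀.nat 8 - 1 := by omega
      by_cases e1 : v = s₀.nat 8
      · simp [e1, h1]
      · by_cases e2 : v = s₀.nat 8 - 1
        · simp [e2, h1.symm]
        · simp [e1, e2, h0 v hv]
    · rw [if_neg (show ¬ (Test.natLE (.var 8) (.var 2)).holds s₀ from h8'), if_pos (by omega)]
      simp [Program.exec, NatTerm.eval, RealTerm.eval, h0 v hv]

lemma predict_keepsNat {u : ℕ} (hu : u < 3) : predict.KeepsNat u := by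
  simp only [predict, applyInverse, computePrediction, computeLeverage, findSignChange,
    clearWeights, fillWeights, bucketLoop, Program.KeepsNat, and_true, true_and]
  omega

lemma predict_keepsReal {a : ℕ} (ha : a ≠ 2) (ha' : a < 5) : predict.KeepsReal a := by
  simp only [predict, applyInverse, computePrediction, computeLeverage, findSignChange,
    clearWeights, fillWeights, bucketLoop, Program.KeepsReal, and_true, true_and]
  omega

lemma update_keepsNat {u : ℕ} (hu : u < 3) : update.KeepsNat u := by
  simp only [update, updateInverse, updateResidual, bucketLoop, Program.KeepsNat, and_true]
  omega

lemma init_keepsNat {u : ℕ} (hu : u < 2) : init.KeepsNat u := by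
  simp only [init, computeLog, computeGridSize, initInverse, bucketLoop, Program.KeepsNat, and_true]
  omega

/-- The program `predict` leaves the products of the inverse Gram matrices with the context, the
leverages, and a forecast that is uncorrelated with the ridge predictions. -/
lemma predict_real (s : Store) :
    (∀ v ≤ s.nat 2, ∀ i < s.nat 1, (predict.exec s).real 5 v i 0 =
      ∑ j ∈ Finset.range (s.nat 1), s.real 3 v i j * s.real 0 j 0 0) ∧
    (∀ v ≤ s.nat 2, (predict.exec s).real 7 v 0 0 = ∑ i ∈ Finset.range (s.nat 1),
      s.real 0 i 0 0 * ∑ j ∈ Finset.range (s.nat 1), s.real 3 v i j * s.real 0 j 0 0) ∧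
    ∃ u j, (∀ v ≤ s.nat 2, u v = ∑ i ∈ Finset.range (s.nat 1),
        (∑ j ∈ Finset.range (s.nat 1), s.real 3 v i j * s.real 0 j 0 0) * s.real 4 v i 0) ∧
      IsSignChange (s.nat 2) u j ∧
      ∀ v ≤ s.nat 2, (predict.exec s).real 2 v 0 0 = defensiveWeights (s.nat 2) u j v := by
  set s₁ := applyInverse.exec s with h₁
  set s₂ := computePrediction.exec s₁ with h₂
  set s₃ := computeLeverage.exec s₂ with h₃
  set s₄ := findSignChange.exec s₃ with h₄
  set s₅ := clearWeights.exec s₄ with h₅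
  set s₆ := fillWeights.exec s₅ with h₆
  have hs : predict.exec s = s₆ := rfl
  have n₁ : ∀ u < 3, s₁.nat u = s.nat u := fun u hu => Program.exec_nat
    (by simp only [applyInverse, bucketLoop, Program.KeepsNat, and_true, true_and]; omega) s
  have n₂ : ∀ u < 3, s₂.nat u = s.nat u := fun u hu => (Program.exec_nat
    (by simp only [computePrediction, bucketLoop, Program.KeepsNat, and_true, true_and]; omega) s₁).trans (n₁ u hu)
  have n₃ : ∀ u < 3, s₃.nat u = s.nat u := fun u hu => (Program.exec_nat
    (by simp only [computeLeverage, bucketLoop, Program.KeepsNat, and_true, true_and]; omega) s₂).trans (n₂ u hu)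
  have n₄ : ∀ u < 3, s₄.nat u = s.nat u := fun u hu => (Program.exec_nat
    (by simp only [findSignChange, bucketLoop, Program.KeepsNat, true_and]; omega) s₃).trans (n₃ u hu)
  have n₅ : ∀ u, u ≠ 3 → s₅.nat u = s₄.nat u := fun u hu => Program.exec_nat
    (by simp only [clearWeights, bucketLoop, Program.KeepsNat, and_true]; omega) s₄
  have r₁ : ∀ a, a ≠ 5 → s₁.real a = s.real a := fun a ha => Program.exec_real
    (by simp only [applyInverse, bucketLoop, Program.KeepsReal]; omega) s
  have r₂ : ∀ a, a ≠ 6 → s₂.real a = s₁.real a := fun a ha => Program.exec_real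
    (by simp only [computePrediction, bucketLoop, Program.KeepsReal]; omega) s₁
  have r₃ : ∀ a, a ≠ 7 → s₃.real a = s₂.real a := fun a ha => Program.exec_real
    (by simp only [computeLeverage, bucketLoop, Program.KeepsReal]; omega) s₂
  have r₄ : ∀ a, s₄.real a = s₃.real a := fun a => Program.exec_real
    (by simp only [findSignChange, bucketLoop, Program.KeepsReal, and_true]) s₃
  have r₅ : ∀ a, a ≠ 2 → s₅.real a = s₄.real a := fun a ha => Program.exec_real
    (by simp only [clearWeights, bucketLoop, Program.KeepsReal]; omega) s₄
  have r₆ : ∀ a, a ≠ 2 → s₆.real a = s₅.real a := fun a ha => Program.exec_real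
    (by simp only [fillWeights, Program.KeepsReal]; omega) s₅
  have e₁ : ∀ v ≤ s.nat 2, ∀ i < s.nat 1, s₁.real 5 v i 0 =
      ∑ j ∈ Finset.range (s.nat 1), s.real 3 v i j * s.real 0 j 0 0 :=
    fun v hv i hi => applyInverse_real s hv hi
  rw [hs]
  refine ⟨fun v hv i hi => ?_, fun v hv => ?_, fun v => s₅.real 6 v 0 0, s₅.nat 8, fun v hv => ?_,
    ?_, fun v hv => ?_⟩
  · rw [r₆ 5 (by omega), r₅ 5 (by omega), r₄, r₃ 5 (by omega), r₂ 5 (by omega), e₁ v hv i hi]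
  · rw [r₆ 7 (by omega), r₅ 7 (by omega), r₄, h₃, computeLeverage_real s₂ (by rwa [n₂ 2 (by omega)]),
      n₂ 1 (by omega)]
    refine Finset.sum_congr rfl fun i hi => ?_
    rw [r₂ 0 (by omega), r₁ 0 (by omega), r₂ 5 (by omega), e₁ v hv i (Finset.mem_range.1 hi)]
  · simp only
    rw [r₅ 6 (by omega), r₄, r₃ 6 (by omega), h₂,
      computePrediction_real s₁ (by rwa [n₁ 2 (by omega)]), n₁ 1 (by omega)]
    refine Finset.sum_congr rfl fun i hi => ?_
    rw [r₁ 4 (by omega), e₁ v hv i (Finset.mem_range.1 hi)]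
  · have h := findSignChange_nat s₃
    rw [n₃ 2 (by omega)] at h
    rw [n₅ 8 (by omega), r₅ 6 (by omega), r₄]
    exact h
  · have e₅ : s₅.nat 2 = s.nat 2 := by rw [n₅ 2 (by omega), n₄ 2 (by omega)]
    have h := fillWeights_real s₅ (v := v)
      (fun v hv => clearWeights_real s₄ (by rwa [← n₅ 2 (by omega)])) (by rwa [e₅])
    rwa [e₅] at h

lemma update_real (s : Store) {v i : ℕ} (hv : v ≤ s.nat 2) (hi : i < s.nat 1) :
    (∀ j < s.nat 1, (update.exec s).real 3 v i j = s.real 3 v i j -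
      s.real 2 v 0 0 / (1 + s.real 2 v 0 0 * s.real 7 v 0 0) *
        (s.real 5 v i 0 * s.real 5 v j 0)) ∧
    (update.exec s).real 4 v i 0 = s.real 4 v i 0 +
      s.real 2 v 0 0 * (s.real 1 0 0 0 - (v : ℝ) / s.nat 2) * s.real 0 i 0 0 := by
  set s₁ := updateInverse.exec s with h₁
  have hs : update.exec s = updateResidual.exec s₁ := rfl
  have n₁ : ∀ u < 3, s₁.nat u = s.nat u := fun u hu => Program.exec_nat
    (by simp only [updateInverse, bucketLoop, Program.KeepsNat, and_true]; omega) s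
  have r₁ : ∀ a, a ≠ 3 → s₁.real a = s.real a := fun a ha => Program.exec_real
    (by simp only [updateInverse, bucketLoop, Program.KeepsReal]; omega) s
  rw [hs]
  constructor
  · intro j hj
    rw [Program.exec_real (by simp only [updateResidual, bucketLoop, Program.KeepsReal]; omega) s₁,
      h₁, updateInverse_real s hv hi hj]
  · rw [updateResidual_real s₁ (by rwa [n₁ 2 (by omega)]) (by rwa [n₁ 1 (by omega)]),
      n₁ 2 (by omega), r₁ 4 (by omega), r₁ 2 (by omega), r₁ 1 (by omega), r₁ 0 (by omega)]

/-! ### The invariant -/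

open Matrix

variable {T d : ℕ} (x : ℕ → EuclideanSpace ℝ (Fin d)) (y : ℕ → Bool)

/-- Before round `t` the memory holds the inverse Gram matrix and the residual sum of each
bucket. -/
structure StoreInvariant (T : ℕ) (t : ℕ) : Prop where
  nat_one : (algorithm.storeBefore T x y t).nat 1 = d
  nat_two : (algorithm.storeBefore T x y t).nat 2 = algorithm.gridSize T d
  inverse : ∀ (v : Fin (algorithm.gridSize T d + 1)) (i j : Fin d),
    (algorithm.storeBefore T x y t).real 3 v i j =
      (gramMatrix (fun t => algorithm.weights T x y t v) (fun t => (x t).ofLp) t)⁻¹ i j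
  residual : ∀ (v : Fin (algorithm.gridSize T d + 1)) (i : Fin d),
    (algorithm.storeBefore T x y t).real 4 v i 0 =
      residualSum (fun t => algorithm.weights T x y t v)
        (fun t => labelValue (y t) - gridPoint _ v) (fun t => (x t).ofLp) t i

lemma storeInvariant_zero : StoreInvariant x y T 0 where
  nat_one := Program.exec_nat (init_keepsNat (by omega)) _
  nat_two := rfl
  inverse v i j := by
    have h1 : ((4 : ℝ) • (1 : Matrix (Fin d) (Fin d) ℝ))⁻¹ = (1 / 4 : ℝ) • 1 := by
      refine Matrix.inv_eq_right_inv ?_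
      rw [smul_mul_smul_comm]
      norm_num
    rw [gramMatrix, Finset.range_zero, Finset.sum_empty, add_zero, h1]
    set s₁ := (Program.seq computeLog computeGridSize).exec (OnlineAlgorithm.startStore T d) with hs
    have hr : s₁.real 3 = (OnlineAlgorithm.startStore T d).real 3 := Program.exec_real
      (by simp [computeLog, computeGridSize, Program.KeepsReal]) _
    have hn : s₁.nat 1 = d := Program.exec_nat
      (by simp [computeLog, computeGridSize, Program.KeepsNat]) _
    have hN : s₁.nat 2 = algorithm.gridSize T d := (Program.exec_nat (c := initInverse)
      (by simp [initInverse, bucketLoop, Program.KeepsNat]) s₁).symm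
    have h2 := initInverse_real s₁ (fun v i j => by rw [hr]; rfl) (v := v) (i := i) (j := j)
      (by rw [hN]; omega) (by rw [hn]; exact i.2)
    refine h2.trans ?_
    rw [Matrix.smul_apply, Matrix.one_apply]
    simp [Fin.ext_iff]
  residual v i := by
    have hr : (init.exec (OnlineAlgorithm.startStore T d)).real 4 =
        (OnlineAlgorithm.startStore T d).real 4 := Program.exec_real
      (by simp [init, initInverse, bucketLoop, computeLog, computeGridSize, Program.KeepsReal]) _
    change (init.exec (OnlineAlgorithm.startStore T d)).real 4 v i 0 = _
    rw [hr]
    simp [residualSum, OnlineAlgorithm.startStore]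

/-- The forecast of a round, given the invariant. -/
lemma StoreInvariant.predict {t : ℕ} (h : StoreInvariant x y T t) :
    (∀ (v : Fin (algorithm.gridSize T d + 1)) (i : Fin d),
      (algorithm.storePredicted T x y t).real 5 v i 0 =
        ((gramMatrix (fun t => algorithm.weights T x y t v) (fun t => (x t).ofLp) t)⁻¹ *ᵥ
          (x t).ofLp) i) ∧
    (∀ v : Fin (algorithm.gridSize T d + 1), (algorithm.storePredicted T x y t).real 7 v 0 0 =
      leverage (fun t => algorithm.weights T x y t v) (fun t => (x t).ofLp) t) ∧
    ∃ u j, (∀ v : Fin (algorithm.gridSize T d + 1),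
        u v = bucketPrediction x y (algorithm.weights T x y) t v) ∧
      IsSignChange (algorithm.gridSize T d) u j ∧
      ∀ v, algorithm.weights T x y t v = defensiveWeights (algorithm.gridSize T d) u j v := by
  set s := OnlineAlgorithm.writeContext (x t) (algorithm.storeBefore T x y t) with hs
  have h0 : ∀ i : Fin d, s.real 0 i 0 0 = x t i := fun i => by
    simp [hs, OnlineAlgorithm.writeContext]
  have hr : ∀ a, a ≠ 0 → s.real a = (algorithm.storeBefore T x y t).real a := fun a ha => by
    funext i j k
    simp [hs, OnlineAlgorithm.writeContext, ha]
  have n1 : s.nat 1 = d := h.nat_one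
  have n2 : s.nat 2 = algorithm.gridSize T d := h.nat_two
  have hp : algorithm.storePredicted T x y t = Forecaster.predict.exec s := rfl
  obtain ⟨h5, h7, u, j, hu, hj, hw⟩ := predict_real s
  rw [n1, n2] at h5
  rw [n1, n2] at h7
  rw [n1, n2] at hu
  rw [n2] at hj hw
  have hz : ∀ (v : Fin (algorithm.gridSize T d + 1)) (i : Fin d),
      ∑ j ∈ Finset.range d, s.real 3 v i j * s.real 0 j 0 0 =
      ((gramMatrix (fun t => algorithm.weights T x y t v) (fun t => (x t).ofLp) t)⁻¹ *ᵥ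
          (x t).ofLp) i := by
    intro v i
    rw [Finset.sum_range, mulVec, dotProduct]
    refine Finset.sum_congr rfl fun j _ => ?_
    rw [hr 3 (by omega), h.inverse, h0]
  refine ⟨fun v i => ?_, fun v => ?_, u, j, fun v => ?_, hj, fun v => hw v (by omega)⟩
  · rw [hp, h5 v (by omega) i i.2, hz]
  · rw [hp, h7 v (by omega), Finset.sum_range, leverage, dotProduct]
    exact Finset.sum_congr rfl fun i _ => by rw [hz, h0]
  · rw [hu v (by omega), Finset.sum_range, bucketPrediction, ridgePrediction, dotProduct]
    refine Finset.sum_congr rfl fun i _ => ?_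
    rw [hz, hr 4 (by omega), h.residual]

lemma StoreInvariant.weights_mem {t : ℕ} (h : StoreInvariant x y T t) :
    algorithm.weights T x y t ∈ stdSimplex ℝ (Fin (algorithm.gridSize T d + 1)) := by
  obtain ⟨-, -, u, j, -, hj, hw⟩ := h.predict
  refine ⟨fun v => by rw [hw]; exact defensiveWeights_nonneg hj v, ?_⟩
  rw [← sum_defensiveWeights_eq_one hj, Finset.sum_range]
  exact Finset.sum_congr rfl fun v _ => hw v

lemma StoreInvariant.sum_le {t : ℕ} (h : StoreInvariant x y T t)
    (hN : 1 ≤ algorithm.gridSize T d) :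
    ∑ v, algorithm.weights T x y t v * (2 * (labelValue (y t) - gridPoint _ v) *
      bucketPrediction x y (algorithm.weights T x y) t v -
      bucketPrediction x y (algorithm.weights T x y) t v ^ 2 / 2) ≤
      1 / (algorithm.gridSize T d : ℝ) ^ 2 := by
  obtain ⟨-, -, u, j, hu, hj, hw⟩ := h.predict
  refine le_trans (le_of_eq ?_) (sum_defensiveWeights_mul_le hN hj (y t))
  rw [Finset.sum_range]
  refine Finset.sum_congr rfl fun v _ => ?_
  rw [hw, ← hu]
  rfl

/-- `predict` leaves the arrays 3 and 4 untouched, so `update` still finds the previous state there.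
Nonnegative weights keep the Sherman–Morrison denominators positive, which is why the earlier
forecasts must be known to be distributions. -/
lemma StoreInvariant.succ {t : ℕ} (h : StoreInvariant x y T t)
    (hw : ∀ s < t + 1, algorithm.weights T x y s ∈ stdSimplex ℝ (Fin (algorithm.gridSize T d + 1)))
    (hx : ‖x t‖ ≤ 1) : StoreInvariant x y T (t + 1) := by
  obtain ⟨h5, h7, -⟩ := h.predict
  set s := OnlineAlgorithm.writeLabel (y t) (algorithm.storePredicted T x y t) with hs
  have hsucc : algorithm.storeBefore T x y (t + 1) = update.exec s := rfl
  have hn : ∀ u < 3, s.nat u = (algorithm.storeBefore T x y t).nat u := fun u hu =>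
    Program.exec_nat (c := Forecaster.predict) (predict_keepsNat hu) _
  have hrp : ∀ a, a ≠ 1 → s.real a = (algorithm.storePredicted T x y t).real a := fun a ha => by
    funext i j k
    simp [hs, OnlineAlgorithm.writeLabel, ha]
  have hr : ∀ a, a ≠ 1 → a ≠ 2 → a ≠ 0 → a < 5 →
      s.real a = (algorithm.storeBefore T x y t).real a := fun a h1 h2 h0 h5 => by
    rw [hrp a h1]
    refine (Program.exec_real (c := Forecaster.predict) (predict_keepsReal h2 h5) _).trans ?_
    funext i j k
    simp [OnlineAlgorithm.writeContext, h0]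
  have hr0 : ∀ i : Fin d, s.real 0 i 0 0 = x t i := fun i => by
    rw [hrp 0 (by omega)]
    have : (algorithm.storePredicted T x y t).real 0 =
      (OnlineAlgorithm.writeContext (x t) (algorithm.storeBefore T x y t)).real 0 :=
      Program.exec_real (c := Forecaster.predict) (predict_keepsReal (by omega) (by omega)) _
    rw [this]
    simp [OnlineAlgorithm.writeContext]
  have hr1 : s.real 1 0 0 0 = labelValue (y t) := by
    simp [hs, OnlineAlgorithm.writeLabel, labelValue]
  have n1 : s.nat 1 = d := (hn 1 (by omega)).trans h.nat_one
  have n2 : s.nat 2 = algorithm.gridSize T d := (hn 2 (by omega)).trans h.nat_two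
  have hr2 : ∀ v : Fin (algorithm.gridSize T d + 1), s.real 2 v 0 0 = algorithm.weights T x y t v :=
    fun v => by rw [hrp 2 (by omega)]; rfl
  have ha : (x t).ofLp ⬝ᵥ (x t).ofLp ≤ 1 := by
    rw [dotProduct_ofLp]
    exact pow_le_one₀ (norm_nonneg _) hx
  constructor
  · rw [hsucc, Program.exec_nat (update_keepsNat (by omega)), n1]
  · rw [hsucc, Program.exec_nat (update_keepsNat (by omega)), n2]
  · intro v i j
    rw [hsucc, (update_real s (v := v) (i := i) (by omega) (by omega)).1 j (by omega),
      hr 3 (by omega) (by omega) (by omega) (by omega), h.inverse, hr2, hrp 7 (by omega),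
      hrp 5 (by omega), h5, h5, h7, inv_gramMatrix_succ t (fun s hs => (hw s hs).1 v) ha,
      Matrix.sub_apply, Matrix.smul_apply, vecMulVec_apply, smul_eq_mul]
  · intro v i
    rw [hsucc, (update_real s (v := v) (i := i) (by omega) (by omega)).2,
      hr 4 (by omega) (by omega) (by omega) (by omega), h.residual, hr2, hr1, hr0,
      residualSum_succ, n2]
    rfl

/-- Both claims need a common induction: the invariant at t makes the forecast of round t a
distribution, and this in turn carries the invariant to t + 1. There is no circularity, as the Gram
matrix at t uses only weights of earlier rounds. -/
theorem storeInvariant (hx : ∀ t < T, ‖x t‖ ≤ 1) :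
    ∀ t ≤ T, StoreInvariant x y T t ∧ ∀ s < t,
      algorithm.weights T x y s ∈ stdSimplex ℝ (Fin (algorithm.gridSize T d + 1)) := by
  intro t
  induction t with
  | zero => exact fun _ => ⟨storeInvariant_zero x y, fun s hs => absurd hs (by omega)⟩
  | succ t ih =>
    intro ht
    obtain ⟨h, hw⟩ := ih (by omega)
    have hw' : ∀ s < t + 1, algorithm.weights T x y s ∈
        stdSimplex ℝ (Fin (algorithm.gridSize T d + 1)) := fun s hs =>
      (Nat.lt_succ_iff_lt_or_eq.1 hs).elim (hw s) fun e => e ▸ h.weights_mem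
    exact ⟨h.succ x y hw' (hx t (by omega)), hw'⟩

/-! ### The grid size and the running time -/

/-- The variable 6 holds the power of two whose exponent is in the variable 7, doubled while it is
at most T. T iterations suffice because T < 2^T. -/
lemma computeLog_nat (s₀ : Store) (h0 : s₀.nat 7 = 0) (hT : 1 ≤ s₀.nat 0) :
    s₀.nat 0 < 2 ^ (computeLog.exec s₀).nat 7 ∧ 2 ^ (computeLog.exec s₀).nat 7 ≤ 2 * s₀.nat 0 := by
  rw [computeLog, Program.exec_seq, Program.exec_loop]
  have hb : NatTerm.eval ((Program.setNat 6 (.const 1)).exec s₀) (.var 0) = s₀.nat 0 := by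
    simp [NatTerm.eval, Program.exec]
  rw [hb]
  obtain ⟨-, h1, h2, h3⟩ := iterate_induction (v := 3) (n := s₀.nat 0)
    (s := (Program.setNat 6 (.const 1)).exec s₀)
    (body := (Program.ite (.natLE (.var 6) (.var 0))
      (.seq (.setNat 6 (.plus (.var 6) (.var 6))) (.setNat 7 (.plus (.var 7) (.const 1))))
      .skip).exec)
    (I := fun n s => s.nat 0 = s₀.nat 0 ∧ s.nat 6 = 2 ^ s.nat 7 ∧ 2 ^ s.nat 7 ≤ 2 * s₀.nat 0 ∧
      (s.nat 7 = n ∨ s₀.nat 0 < 2 ^ s.nat 7))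
    (by simp [Program.exec, NatTerm.eval, h0]; omega) (by
      rintro m - s ⟨e, h1, h2, h3⟩
      rw [Program.exec_ite]
      split_ifs with ht
      · simp [Test.holds, NatTerm.eval, e, h1] at ht
        refine ⟨by simp [Program.exec, e], ?_, ?_, ?_⟩
        · simp [Program.exec, NatTerm.eval, h1, pow_succ]; ring
        · simp [Program.exec, NatTerm.eval, pow_succ]; omega
        · simp [Program.exec, NatTerm.eval]
          exact Or.inl (h3.resolve_right (by omega))
      · simp [Test.holds, NatTerm.eval, e, h1] at ht
        refine ⟨by simp [Program.exec, e], ?_, ?_, ?_⟩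
        · simpa [Program.exec] using h1
        · simpa [Program.exec] using h2
        · exact Or.inr (by simpa [Program.exec] using ht))
  refine ⟨h3.elim (fun h => ?_) id, h2⟩
  rw [h]
  exact Nat.lt_two_pow_self

lemma computeGridSize_nat (s₀ : Store) (h0 : s₀.nat 2 = 0) :
    (computeGridSize.exec s₀).nat 2 ≤ s₀.nat 0 ∧
    (0 < (computeGridSize.exec s₀).nat 2 →
      (((computeGridSize.exec s₀).nat 2 - 1 : ℕ) : ℝ) ^ 3 * (s₀.nat 1 * s₀.nat 7) ≤ s₀.nat 0) ∧
    ∀ m < s₀.nat 0, (m : ℝ) ^ 3 * (s₀.nat 1 * s₀.nat 7) ≤ s₀.nat 0 →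
      m < (computeGridSize.exec s₀).nat 2 := by
  rw [computeGridSize, Program.exec_loop]
  refine (iterate_induction (n := NatTerm.eval s₀ (.var 0))
    (I := fun n s => (s.nat 0 = s₀.nat 0 ∧ s.nat 1 = s₀.nat 1 ∧ s.nat 7 = s₀.nat 7) ∧
      s.nat 2 ≤ n ∧ (0 < s.nat 2 → ((s.nat 2 - 1 : ℕ) : ℝ) ^ 3 *
        (s₀.nat 1 * s₀.nat 7) ≤ s₀.nat 0) ∧
      ∀ m < n, (m : ℝ) ^ 3 * (s₀.nat 1 * s₀.nat 7) ≤ s₀.nat 0 → m < s.nat 2)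
    (by simp [h0]) ?_).2
  rintro m - s ⟨⟨e0, e1, e7⟩, h1, h2, h3⟩
  have hcube : (m : ℝ) ^ 3 = m * (m * m) := by ring
  rw [Program.exec_ite]
  split_ifs with ht
  · simp [Test.holds, NatTerm.eval, RealTerm.eval, e0, e1, e7] at ht
    refine ⟨by simp [Program.exec, e0, e1, e7], ?_, ?_, ?_⟩
    · simp [Program.exec, NatTerm.eval]
    · simpa [Program.exec, NatTerm.eval, hcube] using ht
    · simp only [Program.exec, NatTerm.eval, Store.setNat_nat, if_true]
      exact fun i hi _ => hi
  · simp [Test.holds, NatTerm.eval, RealTerm.eval, e0, e1, e7] at ht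
    refine ⟨by simp [Program.exec, e0, e1, e7], ?_, ?_, ?_⟩
    · simp [Program.exec]; omega
    · simpa [Program.exec] using h2
    · simp only [Program.exec, Store.setNat_nat]
      intro i hi hi'
      rcases Nat.lt_succ_iff_lt_or_eq.1 hi with h | rfl
      · simpa using h3 i h hi'
      · rw [hcube] at hi'
        linarith

/-- The choice of the grid size: `N ^ 3 ≈ T / (d log T)`. -/
theorem exists_gridSize_bounds {T d : ℕ} (hT : 2 ≤ T) (hd : 1 ≤ d) :
    1 ≤ algorithm.gridSize T d ∧ algorithm.gridSize T d ≤ T ∧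
    ∃ L : ℝ, Real.log T ≤ L ∧ L ≤ 3 * Real.log T ∧
      ((algorithm.gridSize T d : ℝ) - 1) ^ 3 * (d * L) ≤ T ∧
      (T : ℝ) ≤ (algorithm.gridSize T d : ℝ) ^ 3 * (d * L) := by
  set s₀ := OnlineAlgorithm.startStore T d with hs₀
  set s₁ := computeLog.exec s₀ with hs₁
  have hN : algorithm.gridSize T d = (computeGridSize.exec s₁).nat 2 :=
    Program.exec_nat (c := initInverse) (by simp [initInverse, bucketLoop, Program.KeepsNat]) _
  obtain ⟨l1, l2⟩ := computeLog_nat s₀ rfl (show 1 ≤ T by omega)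
  rw [show s₀.nat 0 = T from rfl, ← hs₁] at l1 l2
  have n : ∀ u < 3, s₁.nat u = s₀.nat u := fun u hu => Program.exec_nat
    (by simp only [computeLog, Program.KeepsNat, and_true]; omega) s₀
  obtain ⟨g1, g2, g3⟩ := computeGridSize_nat s₁ (n 2 (by omega))
  rw [n 0 (by omega), show s₀.nat 0 = T from rfl] at g1 g2 g3
  rw [n 1 (by omega), show s₀.nat 1 = d from rfl] at g2 g3
  rw [← hN] at g1 g2 g3
  set N := algorithm.gridSize T d
  set ℓ := s₁.nat 7 with hℓ
  have hN1 : 1 ≤ N := g3 0 (by omega) (by simp)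
  have hT' : (2 : ℝ) ≤ T := by exact_mod_cast hT
  have hlog2 := Real.log_two_gt_d9
  have hlogT : Real.log 2 ≤ Real.log T := Real.log_le_log (by norm_num) hT'
  have m1 : Real.log T ≤ ℓ * Real.log 2 := by
    rw [← Real.log_pow]
    exact Real.log_le_log (by linarith) (by exact_mod_cast l1.le)
  have m2 : ℓ * Real.log 2 ≤ Real.log 2 + Real.log T := by
    rw [← Real.log_pow, ← Real.log_mul (by norm_num) (by linarith)]
    exact Real.log_le_log (by positivity) (by exact_mod_cast l2)
  have hlog2' := Real.log_two_lt_d9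
  have hℓ0 : (0 : ℝ) ≤ ℓ := Nat.cast_nonneg _
  have hL1 : Real.log T ≤ ℓ := by nlinarith
  refine ⟨hN1, g1, ℓ, hL1, by nlinarith, ?_, ?_⟩
  · have := g2 hN1
    rwa [Nat.cast_sub hN1, Nat.cast_one] at this
  -- If N < T, then N itself was a candidate and failed the test. If N = T, the search was cut off
  -- by its range, and T ≤ T³ suffices.
  · rcases g1.lt_or_eq with h | h
    · by_contra hcon
      exact absurd (g3 N h (not_le.1 hcon).le) (lt_irrefl _)
    · have hd' : (1 : ℝ) ≤ d := by exact_mod_cast hd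
      have hℓ1 : (1 : ℝ) ≤ ℓ := by
        have : ℓ ≠ 0 := by
          intro h0
          rw [h0] at l1
          omega
        exact_mod_cast Nat.one_le_iff_ne_zero.2 this
      have h1 : (1 : ℝ) ≤ d * ℓ := one_le_mul_of_one_le_of_one_le hd' hℓ1
      rw [h]
      have h2 : (T : ℝ) ≤ (T : ℝ) ^ 3 := le_self_pow₀ (by linarith) (by norm_num)
      nlinarith [show (0 : ℝ) ≤ (T : ℝ) ^ 3 by positivity]

/-- The algorithm runs in polynomial time. -/
theorem exists_totalTime_le : ∃ c : ℕ, ∀ {T d : ℕ}, 2 ≤ T → 1 ≤ d →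
    ∀ (x : ℕ → EuclideanSpace ℝ (Fin d)) (y : ℕ → Bool),
      algorithm.totalTime T x y ≤ c * (T + d) ^ c := by
  -- Initialization is treated in two phases, because its first phase assigns the variable 2 that
  -- bounds the loops of the second.
  obtain ⟨a₀, h₀⟩ := Program.exists_time_le (V := {0}) (c := .seq computeLog computeGridSize)
    (by simp [computeLog, computeGridSize, Program.LoopsBoundedBy])
  obtain ⟨a₁, h₁⟩ := Program.exists_time_le (V := {1, 2}) (c := initInverse)
    (by simp [initInverse, bucketLoop, Program.LoopsBoundedBy])
  obtain ⟨a₂, h₂⟩ := Program.exists_time_le (V := {1, 2}) (c := predict)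
    (by simp [predict, applyInverse, computePrediction, computeLeverage, findSignChange,
      clearWeights, fillWeights, bucketLoop, Program.LoopsBoundedBy])
  obtain ⟨a₃, h₃⟩ := Program.exists_time_le (V := {1, 2}) (c := update)
    (by simp [update, updateInverse, updateResidual, bucketLoop, Program.LoopsBoundedBy])
  set m := (a₀ + a₁ + 1) + (((a₂ + 1 + 1) + a₃ + 1) + 1) + 1 with hm
  -- The same constant has to serve as factor and exponent; 2^m is the factor that arises, and it
  -- exceeds the exponent m.
  refine ⟨2 ^ m, fun {T d} hT hd x y => ?_⟩
  obtain ⟨-, hNT, -⟩ := exists_gridSize_bounds hT hd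
  set K := T + d with hK
  have hn : ∀ t, (algorithm.storeBefore T x y t).nat 1 = d ∧
      (algorithm.storeBefore T x y t).nat 2 = algorithm.gridSize T d := by
    intro t
    induction t with
    | zero => exact ⟨Program.exec_nat (init_keepsNat (by omega)) _, rfl⟩
    | succ t ih =>
      have h : ∀ u < 3, (algorithm.storeBefore T x y (t + 1)).nat u =
          (algorithm.storeBefore T x y t).nat u := fun u hu =>
        (Program.exec_nat (c := update) (update_keepsNat hu) _).trans
          (Program.exec_nat (c := predict) (predict_keepsNat hu) _)
      exact ⟨(h 1 (by omega)).trans ih.1, (h 2 (by omega)).trans ih.2⟩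
  have hinit : algorithm.init.time (OnlineAlgorithm.startStore T d) ≤ (K + 2) ^ (a₀ + a₁ + 1) := by
    refine (add_le_add (h₀ K _ ?_) (h₁ K _ ?_)).trans (pow_add_pow_le K a₀ a₁)
    · simp [OnlineAlgorithm.startStore, hK]
    · set s₁ := (Program.seq computeLog computeGridSize).exec (OnlineAlgorithm.startStore T d)
      have e1 : s₁.nat 1 = d := Program.exec_nat
        (by simp [computeLog, computeGridSize, Program.KeepsNat]) _
      have e2 : s₁.nat 2 = algorithm.gridSize T d := (Program.exec_nat (c := initInverse)
        (by simp [initInverse, bucketLoop, Program.KeepsNat]) s₁).symm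
      simp only [Finset.mem_insert, Finset.mem_singleton, forall_eq_or_imp, forall_eq, e1, e2]
      omega
  have hround : ∀ t ∈ Finset.range T,
      algorithm.predict.time (OnlineAlgorithm.writeContext (x t) (algorithm.storeBefore T x y t)) +
        (algorithm.gridSize T d + 1) +
        algorithm.update.time
          (OnlineAlgorithm.writeLabel (y t) (algorithm.storePredicted T x y t)) ≤
      (K + 2) ^ ((a₂ + 1 + 1) + a₃ + 1) := by
    intro t _
    obtain ⟨e1, e2⟩ := hn t
    have hp : ∀ u < 3, (algorithm.storePredicted T x y t).nat u =
        (algorithm.storeBefore T x y t).nat u := fun u hu =>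
      Program.exec_nat (c := predict) (predict_keepsNat hu) _
    refine (add_le_add ((add_le_add (h₂ K _ ?_) ?_).trans (pow_add_pow_le K a₂ 1))
      (h₃ K _ ?_)).trans (pow_add_pow_le K _ a₃)
    · simp only [Finset.mem_insert, Finset.mem_singleton, forall_eq_or_imp, forall_eq,
        OnlineAlgorithm.writeContext, e1, e2]
      omega
    · rw [pow_one]
      omega
    · simp only [Finset.mem_insert, Finset.mem_singleton, forall_eq_or_imp, forall_eq,
        OnlineAlgorithm.writeLabel, Store.setReal_nat, hp 1 (by omega), hp 2 (by omega), e1, e2]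
      omega
  calc algorithm.totalTime T x y ≤ (K + 2) ^ (a₀ + a₁ + 1) +
        ∑ t ∈ Finset.range T, (K + 2) ^ ((a₂ + 1 + 1) + a₃ + 1) :=
        add_le_add hinit (Finset.sum_le_sum hround)
    _ ≤ (K + 2) ^ (a₀ + a₁ + 1) + (K + 2) ^ (((a₂ + 1 + 1) + a₃ + 1) + 1) := by
        rw [Finset.sum_const, Finset.card_range, smul_eq_mul, pow_succ _ ((a₂ + 1 + 1) + a₃ + 1),
          mul_comm T]
        exact Nat.add_le_add_left (Nat.mul_le_mul_left _ (by omega)) _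
    _ ≤ (K + 2) ^ m := pow_add_pow_le K _ _
    _ ≤ (2 * K) ^ m := Nat.pow_le_pow_left (by omega) m
    _ = 2 ^ m * K ^ m := mul_pow _ _ _
    _ ≤ 2 ^ m * K ^ 2 ^ m :=
        Nat.mul_le_mul_left _ (Nat.pow_le_pow_right (by omega) Nat.lt_two_pow_self.le)

end Forecaster

/-! ### Balancing the parameters -/

/-- The deterministic bound for the balanced choice `N ≈ α / β` of the grid size. -/
lemma sqrt_add_sqrt_le {T N d Λ L α β : ℝ} (hT : 2 ≤ T) (hN : 1 ≤ N) (hNT : N ≤ T) (hd : 1 ≤ d)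
    (hΛ : Λ = Real.log T) (hL : Λ ≤ L) (hL' : L ≤ 3 * Λ) (h₁ : (N - 1) ^ 3 * (d * L) ≤ T)
    (h₂ : T ≤ N ^ 3 * (d * L)) (hα : 0 < α) (hβ : 0 < β) (hαT : α ^ 3 = T)
    (hβd : β ^ 3 = d * Λ) (hβα : β ≤ α) :
    √((4 * (N + 1) + T) * (T * (1 / N ^ 2) + 2 * (N + 1) * (d * Real.log (4 * d + T)))) +
      √((N + 1) * T) ≤ 17 * (α ^ 2 * β) := by
  have hΛ0 : 0.69 ≤ Λ := by
    have := Real.log_two_gt_d9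
    have := Real.log_le_log (by norm_num) hT
    linarith
  have hdΛ : d * Λ ≤ T := by
    rw [← hαT, ← hβd]
    exact pow_le_pow_left₀ hβ.le hβα 3
  have hN' : 0 < N := by linarith
  -- `N` is within a factor of two of `α / β`
  have hup : β * (N - 1) ≤ α := by
    refine le_of_pow_le_pow_left₀ (n := 3) (by norm_num) hα.le ?_
    rw [mul_pow, hβd, hαT]
    refine le_trans ?_ h₁
    rw [mul_comm]
    exact mul_le_mul_of_nonneg_left (by gcongr) (pow_nonneg (by linarith) 3)
  have hup' : β * (N + 1) ≤ 3 * α := by nlinarith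
  -- The factor 3 between L and log T is absorbed by 2³ = 8.
  have hlow : α ≤ 2 * (β * N) := by
    refine le_of_pow_le_pow_left₀ (n := 3) (by norm_num) (by positivity) ?_
    rw [mul_pow, mul_pow, hβd, hαT]
    refine h₂.trans ?_
    have : N ^ 3 * (d * L) ≤ N ^ 3 * (d * (3 * Λ)) := by gcongr
    nlinarith [show 0 ≤ d * Λ * N ^ 3 by positivity]
  have hlog : Real.log (4 * d + T) ≤ 4 * Λ := by
    have h1 : 4 * d + T ≤ T ^ 4 := by
      have : d ≤ 1.45 * T := by nlinarith
      have h8 : (8 : ℝ) ≤ T ^ 3 := by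
        calc (8 : ℝ) = 2 ^ 3 := by norm_num
          _ ≤ T ^ 3 := by gcongr
      nlinarith [mul_le_mul_of_nonneg_right h8 (by linarith : 0 ≤ T)]
    calc _ ≤ Real.log (T ^ 4) := Real.log_le_log (by linarith) h1
      _ = 4 * Λ := by rw [Real.log_pow, hΛ]; norm_num
  have e1 : T * (1 / N ^ 2) ≤ 4 * (α * β ^ 2) := by
    rw [mul_one_div, div_le_iff₀ (by positivity)]
    have : α ^ 2 ≤ (2 * (β * N)) ^ 2 := by gcongr
    calc T = α * α ^ 2 := by rw [← hαT]; ring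
      _ ≤ α * (2 * (β * N)) ^ 2 := by gcongr
      _ = _ := by ring
  have e2 : 2 * (N + 1) * (d * Real.log (4 * d + T)) ≤ 24 * (α * β ^ 2) := by
    calc _ ≤ 2 * (N + 1) * (d * (4 * Λ)) := by gcongr
      _ = 8 * (β * (N + 1)) * β ^ 2 := by
          rw [show d * (4 * Λ) = 4 * (d * Λ) by ring, ← hβd]; ring
      _ ≤ 8 * (3 * α) * β ^ 2 := by gcongr
      _ = _ := by ring
  have s1 : √((4 * (N + 1) + T) * (T * (1 / N ^ 2) +
      2 * (N + 1) * (d * Real.log (4 * d + T)))) ≤ 14 * (α ^ 2 * β) := by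
    refine Real.sqrt_le_iff.2 ⟨by positivity, ?_⟩
    calc _ ≤ (7 * T) * (4 * (α * β ^ 2) + 24 * (α * β ^ 2)) := by
          have h0 : 0 ≤ Real.log (4 * d + T) := Real.log_nonneg (by linarith)
          gcongr
          linarith
      _ = (14 * (α ^ 2 * β)) ^ 2 := by rw [← hαT]; ring
  have s2 : √((N + 1) * T) ≤ 3 * (α ^ 2 * β) := by
    refine Real.sqrt_le_iff.2 ⟨by positivity, ?_⟩
    -- The sampling term (N+1)T is of order α⁴/β; the lower bound on β³ lets it be compared with
    -- (α²β)².
    have hβ3 : 0.69 ≤ β ^ 3 := by rw [hβd]; nlinarith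
    have h3 : β * ((N + 1) * T) ≤ β * (3 * (α ^ 2 * β)) ^ 2 := by
      calc β * ((N + 1) * T) = (β * (N + 1)) * T := by ring
        _ ≤ (3 * α) * T := by gcongr
        _ = 3 * α ^ 4 * 1 := by rw [← hαT]; ring
        _ ≤ 3 * α ^ 4 * (3 * β ^ 3) := by gcongr; linarith
        _ = β * (3 * (α ^ 2 * β)) ^ 2 := by ring
    exact le_of_mul_le_mul_left h3 hβ
  linarith

open Forecaster in
/-- The conclusion on the sampled bucket sums, in expectation and with high probability. -/
theorem bucketSum_bounds {T d : ℕ} (hT : 2 ≤ T) (hd : 1 ≤ d)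
    {x : ℕ → EuclideanSpace ℝ (Fin d)} (hx : ∀ t < T, ‖x t‖ ≤ 1) (y : ℕ → Bool) :
    ∫ p, ∑ v, ‖bucketSum x y p v‖ ∂(algorithm.law T x y) ≤
      17 * ((T : ℝ) ^ (2 / 3 : ℝ) * (d : ℝ) ^ (1 / 3 : ℝ) * Real.log T ^ (1 / 3 : ℝ)) ∧
    ∀ δ : ℝ, 0 < δ → δ < 1 → 1 - δ ≤ (algorithm.law T x y).real
      {p | ∑ v, ‖bucketSum x y p v‖ ≤
        17 * ((T : ℝ) ^ (2 / 3 : ℝ) * (d : ℝ) ^ (1 / 3 : ℝ) * Real.log T ^ (1 / 3 : ℝ) +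
          (T : ℝ) ^ (2 / 3 : ℝ) * ((d : ℝ) * Real.log T) ^ (-(1 / 6) : ℝ) *
            √(Real.log (1 / δ)))} := by
  have hw := (storeInvariant x y hx T le_rfl).2
  have hdef : ∀ t < T, _ := fun t ht =>
    (storeInvariant x y hx t ht.le).1.sum_le x y (exists_gridSize_bounds hT hd).1
  have hlaw : algorithm.law T x y =
      Measure.pi fun t : Fin T => weightMeasure (algorithm.weights T x y t) := rfl
  have hprob : ∀ t : Fin T, IsProbabilityMeasure (weightMeasure (algorithm.weights T x y t)) :=
    fun t => isProbabilityMeasure_weightMeasure (hw t t.2)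
  rw [hlaw]
  obtain ⟨hN1, hNT, L, hL, hL', g1, g2⟩ := exists_gridSize_bounds hT hd
  set N := algorithm.gridSize T d
  have hT' : (2 : ℝ) ≤ T := by exact_mod_cast hT
  have hd' : (1 : ℝ) ≤ d := by exact_mod_cast hd
  have hlog : 0 < Real.log T := Real.log_pos (by linarith)
  set Λ := Real.log T with hΛ
  set α := (T : ℝ) ^ (1 / 3 : ℝ) with hα
  set β := ((d : ℝ) * Λ) ^ (1 / 3 : ℝ) with hβ
  set γ := ((d : ℝ) * Λ) ^ (-(1 / 6) : ℝ) with hγ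
  have hdΛ : 0 < (d : ℝ) * Λ := by positivity
  have hα0 : 0 < α := by positivity
  have hβ0 : 0 < β := by positivity
  have hγ0 : 0 < γ := by positivity
  have hα3 : α ^ 3 = T := by
    rw [hα, ← Real.rpow_natCast, ← Real.rpow_mul (by linarith)]
    norm_num
  have hβ3 : β ^ 3 = d * Λ := by
    rw [hβ, ← Real.rpow_natCast, ← Real.rpow_mul hdΛ.le]
    norm_num
  have hα2 : (T : ℝ) ^ (2 / 3 : ℝ) = α ^ 2 := by
    rw [hα, ← Real.rpow_natCast, ← Real.rpow_mul (by linarith)]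
    norm_num
  have hγβ : γ ^ 2 * β = 1 := by
    rw [hγ, hβ, ← Real.rpow_natCast, ← Real.rpow_mul hdΛ.le, ← Real.rpow_add hdΛ]
    norm_num
  have hM : (T : ℝ) ^ (2 / 3 : ℝ) * (d : ℝ) ^ (1 / 3 : ℝ) * Λ ^ (1 / 3 : ℝ) = α ^ 2 * β := by
    rw [hα2, mul_assoc, ← Real.mul_rpow (by linarith) hlog.le]
  rw [hM, hα2]
  -- The condition β ≤ α means d log T ≤ T. Then 1 = γ²β ≤ γ²α puts McDiarmid's √T below α²γ. In the
  -- opposite case T = α³ ≤ α²β, and the trivial bound suffices.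
  rcases le_total β α with hβα | hαβ
  · have hmean := sum_norm_meanBucketSum_le hx hw hdef
    have hnum := sqrt_add_sqrt_le (N := N) hT' (by exact_mod_cast hN1) (by exact_mod_cast hNT) hd'
      hΛ hL hL' g1 g2 hα0 hβ0 hα3 hβ3 hβα
    refine ⟨(integral_sum_norm_bucketSum_le y hx hw).trans (by linarith), fun δ hδ hδ' => ?_⟩
    refine (one_sub_le_measureReal_sum_norm_bucketSum y (by omega) hx hw hδ hδ').trans ?_
    refine measureReal_mono fun p hp => ?_
    simp only [mem_ofPred_eq] at hp ⊢
    have hdev : √(2 * T) ≤ 2 * (α ^ 2 * γ) := by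
      refine Real.sqrt_le_iff.2 ⟨by positivity, ?_⟩
      have h1 : 1 ≤ γ ^ 2 * α := by
        rw [← hγβ]
        gcongr
      calc 2 * (T : ℝ) = 2 * α ^ 3 * 1 := by rw [← hα3]; ring
        _ ≤ 4 * α ^ 3 * (γ ^ 2 * α) := by gcongr; norm_num
        _ = _ := by ring
    have h2 : √(2 * T) * √(Real.log (1 / δ)) ≤ 2 * (α ^ 2 * γ) * √(Real.log (1 / δ)) := by gcongr
    have h3 : 0 ≤ α ^ 2 * γ * √(Real.log (1 / δ)) := by positivity
    linarith
  · have hTM : (T : ℝ) ≤ 17 * (α ^ 2 * β) := by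
      calc (T : ℝ) = α ^ 2 * α := by rw [← hα3]; ring
        _ ≤ α ^ 2 * β := by gcongr
        _ ≤ _ := le_mul_of_one_le_left (by positivity) (by norm_num)
    have hG := sum_norm_bucketSum_le (N := N) y hx
    constructor
    · calc _ ≤ ∫ _ : Fin T → Fin (N + 1), 17 * (α ^ 2 * β)
            ∂Measure.pi fun t : Fin T => weightMeasure (algorithm.weights T x y t) :=
            integral_mono Integrable.of_finite (integrable_const _) fun p => (hG p).trans hTM
        _ = _ := by rw [integral_const, probReal_univ, one_smul]
    · intro δ hδ hδ'
      have huniv : {p : Fin T → Fin (N + 1) | ∑ v, ‖bucketSum x y p v‖ ≤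
          17 * (α ^ 2 * β + α ^ 2 * γ * √(Real.log (1 / δ)))} = univ := by
        refine eq_univ_of_forall fun p => ?_
        rw [mem_ofPred_eq]
        have h3 : 0 ≤ α ^ 2 * γ * √(Real.log (1 / δ)) := by positivity
        linarith [hG p]
      rw [huniv, probReal_univ]
      linarith

end SwapOmni

end

/-! ### Assembly of the theorem -/

theorem mainTheorem3 :
    ∃ (A : SwapOmni.OnlineAlgorithm) (C : ℝ) (c : ℕ),
      ∀ (T d : ℕ) [NeZero d], 2 ≤ T →
        1 ≤ A.gridSize T d ∧
        ∀ (x : ℕ → EuclideanSpace ℝ (Fin d)) (y : ℕ → Bool),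
          (∀ t < T, x t ∈ SwapOmni.contexts d) →
          (∀ t < T, A.weights T x y t ∈ stdSimplex ℝ (Fin (A.gridSize T d + 1))) ∧
          A.totalTime T x y ≤ c * (T + d) ^ c ∧
          ∀ k : SwapOmni.Loss → ℝ → ℝ,
            (∀ ℓ ∈ SwapOmni.convexLipschitzLosses, SwapOmni.IsBestResponse ℓ (k ℓ)) →
            (∀ δ : ℝ, 0 < δ → δ < 1 →
              1 - δ ≤ (A.law T x y).real
                {p | SwapOmni.swapOmniprediction SwapOmni.convexLipschitzLosses
                      (SwapOmni.restrictedAffine d) k x y p ≤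
                    C * ((T : ℝ) ^ (2 / 3 : ℝ) * (d : ℝ) ^ (1 / 3 : ℝ)
                          * Real.log T ^ (1 / 3 : ℝ)
                        + (T : ℝ) ^ (2 / 3 : ℝ) * ((d : ℝ) * Real.log T) ^ (-(1 / 6) : ℝ)
                          * Real.sqrt (Real.log (1 / δ)))}) ∧
            ∫ p, SwapOmni.swapOmniprediction SwapOmni.convexLipschitzLosses
                  (SwapOmni.restrictedAffine d) k x y p ∂(A.law T x y) ≤
              C * ((T : ℝ) ^ (2 / 3 : ℝ) * (d : ℝ) ^ (1 / 3 : ℝ) * Real.log T ^ (1 / 3 : ℝ)) := by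
  obtain ⟨c, hc⟩ := SwapOmni.Forecaster.exists_totalTime_le
  refine ⟨SwapOmni.Forecaster.algorithm, 15 * 17, c, fun T d _ hT => ?_⟩
  have hd : 1 ≤ d := NeZero.one_le
  refine ⟨(SwapOmni.Forecaster.exists_gridSize_bounds hT hd).1, fun x y hx => ?_⟩
  have hx' : ∀ t < T, ‖x t‖ ≤ 1 := fun t ht => (hx t ht).1
  have hw := (SwapOmni.Forecaster.storeInvariant x y hx' T le_rfl).2
  refine ⟨hw, hc hT hd x y, fun k hk => ?_⟩
  have hprob : ∀ t : Fin T, IsProbabilityMeasure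
      (SwapOmni.weightMeasure (SwapOmni.Forecaster.algorithm.weights T x y t)) :=
    fun t => SwapOmni.isProbabilityMeasure_weightMeasure (hw t t.2)
  have hfin : IsProbabilityMeasure (SwapOmni.Forecaster.algorithm.law T x y) :=
    inferInstanceAs (IsProbabilityMeasure (Measure.pi fun t : Fin T =>
      SwapOmni.weightMeasure (SwapOmni.Forecaster.algorithm.weights T x y t)))
  obtain ⟨hE, hP⟩ := SwapOmni.bucketSum_bounds hT hd hx' y
  have hle := SwapOmni.swapOmniprediction_le hk hx y
    (N := SwapOmni.Forecaster.algorithm.gridSize T d)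
  constructor
  · intro δ hδ hδ'
    refine (hP δ hδ hδ').trans (measureReal_mono fun p hp => ?_)
    rw [mem_ofPred_eq] at hp ⊢
    rw [mul_assoc]
    exact (hle p).trans (mul_le_mul_of_nonneg_left hp (by norm_num))
  · calc _ ≤ ∫ p, 15 * ∑ v, ‖SwapOmni.bucketSum x y p v‖
          ∂(SwapOmni.Forecaster.algorithm.law T x y) :=
          integral_mono Integrable.of_finite Integrable.of_finite hle
      _ ≤ _ := by
          rw [integral_const_mul, mul_assoc]
          exact mul_le_mul_of_nonneg_left hE (by norm_num)
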